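/- Let $k\ge 2$ and let $\mathbb{Z}/k\mathbb{Z}$ act on the Euclidean plane $\mathbb{R}^2$ by rotations about the origin, the generator acting as the counter-clockwise rotation through angle $2\pi/k$. A cone framework $(\tilde G,\varphi,\tilde{\boldsymbol\ell})$ is a finite graph $\tilde G=(\tilde V,\tilde E)$ with $\tilde V\neq\emptyset$ (loops and multiple edges are allowed), a free action $\varphi$ of $\mathbb{Z}/k\mathbb{Z}$ on $\tilde G$, and an assignment $\tilde{\boldsymbol\ell}$ of a positive length $\tilde{\ell}_{ij}$ to each edge $ij$. A realization is a point set $\mathbf p=(\mathbf p_i)_{i\in\tilde V}$ in $\mathbb{R}^2$ with $\|\mathbf p_j-\mathbf p_i\|=\tilde\ell_{ij}$ for all edges $ij\in\tilde E$ and $\gamma\cdot\mathbf p_i=\mathbf p_{\gamma(i)}$ for all $\gamma\in\mathbb{Z}/k\mathbb{Z}$ and $i\in\tilde V$. A realization is rigid if it is isolated in the configuration space (the space of realizations modulo isometries of the plane), and minimally rigid if it is rigid but ceases to be rigid when any one $\mathbb{Z}/k\mathbb{Z}$-orbit of edges is removed. A realization $\mathbf p$ is generic if the rank of the linear system $\langle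 \mathbf p_j-\mathbf p_i,\mathbf q_j-\mathbf q_i\rangle=0$ ($ij\in\tilde E$), in the unknown $\mathbb{Z}/k\mathbb{Z}$-equivariant velocities $\mathbf q$, is maximal over all realizations of all cone frameworks with the same $(\tilde G,\varphi)$. The colored quotient $(G,\boldsymbol\gamma)$ of $(\tilde G,\varphi)$ is the quotient multigraph $G=\tilde G/(\mathbb{Z}/k\mathbb{Z})$ with an arbitrary orientation of its edges; after a choice of a representative $\tilde i$ in each vertex orbit $i$, an edge of $G$ from $i$ to $j$ has the color $\gamma_{ij}\in\mathbb{Z}/k\mathbb{Z}$ if the corresponding edge orbit contains an edge joining $\tilde i$ to $\gamma_{ij}(\tilde j)$. For a connected subgraph $G'$ of $G$ put $T(G')=0$ if some closed walk in $G'$ has a nonzero sum of colors (colors of edges crossed backwards being counted with a minus sign), and $T(G')=2$ otherwise. The colored graph $(G,\boldsymbol\gamma)$ with $n$ vertices and $m$ edges is cone-Laman if $m=2n-1$ and every subgraph with $n'$ vertices, $m'\ge 1$ edges and connected components $G_1,\dots,G_c$ satisfies $$m'\le 2n'-1-\sum_{i=1}^{c}T(G_i).$$ Theorem. A generic realization of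 a cone framework is minimally rigid if and only if the colored quotient $(G,\boldsymbol\gamma)$ is cone-Laman. -/

import Mathlib

/-! ### Finite graphs with a free cyclic action, and their realizations in the plane

The Euclidean plane is `ℂ`; the residue `g : ZMod k` acts on it as the counter-clockwise rotation
about the origin through the angle `2πg/k`, which is multiplication by the complex number
`ZMod.stdAddChar g = exp (2πig/k)`. -/

/-- A (multi)graph with vertex set `V` and edge set `E`, together with an action of `ZMod k` on it
by graph automorphisms that is free. Loops and parallel edges are allowed. (If `g` fixes an edge
then either `g = 0` or `g` interchanges the endpoints of that edge.) -/
structure ConeGraph (k : ℕ) (V E : Type*) [AddAction (ZMod k) V] [AddAction (ZMod k) E] where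
  /-- the unordered pair of endpoints of an edge -/
  ends : E → Sym2 V
  ends_vadd : ∀ (g : ZMod k) (e : E), ends (g +ᵥ e) = (ends e).map (fun v => g +ᵥ v)
  free : ∀ (g : ZMod k) (v : V), g +ᵥ v = v → g = 0

/-- The real vector space of point configurations `p : V → ℂ` with `p (g • v) = g • p v`. -/
def equivariantMaps (k : ℕ) [NeZero k] (V : Type*) [AddAction (ZMod k) V] :
    Submodule ℝ (V → ℂ) where
  carrier := {p | ∀ (g : ZMod k) (v : V), p (g +ᵥ v) = ZMod.stdAddChar g * p v}
  add_mem' := by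
    intro p q hp hq g v
    simp only [Pi.add_apply, hp g v, hq g v, mul_add]
  zero_mem' := by
    intro g v
    simp
  smul_mem' := by
    intro c p hp g v
    simp only [Pi.smul_apply, hp g v, mul_smul_comm]

namespace ConeGraph

variable {k : ℕ} [NeZero k] {V E : Type*} [AddAction (ZMod k) V] [AddAction (ZMod k) E]

/-- The realization space of the cone framework whose bars are the edges in `S`, with prescribed
lengths `len`. The whole framework is `S = Set.univ`. -/
def realizationSpace (X : ConeGraph k V E) (len : E → ℝ) (S : Set E) : Set (V → ℂ) :=
  {p | p ∈ equivariantMaps k V ∧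
    ∀ e ∈ S, ∀ i j : V, X.ends e = s(i, j) → ‖p j - p i‖ = len e}

/-- Two realizations are congruent if they differ by an isometry of the plane. -/
def congruent (X : ConeGraph k V E) (len : E → ℝ) (S : Set E) :
    Setoid (X.realizationSpace len S) where
  r p q := ∃ ψ : ℂ ≃ᵢ ℂ, ∀ v, q.1 v = ψ (p.1 v)
  iseqv :=
    { refl := fun p => ⟨IsometryEquiv.refl ℂ, fun _ => rfl⟩
      symm := fun {p q} ⟨ψ, h⟩ => ⟨ψ.symm, fun v => by rw [h v, ψ.symm_apply_apply]⟩
      trans := fun {p q r} ⟨ψ, h⟩ ⟨χ, h'⟩ => ⟨ψ.trans χ, fun v => by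
        rw [h' v, h v, IsometryEquiv.trans_apply]⟩ }

/-- The configuration space: the realization space modulo isometries of the plane, with the
quotient topology. -/
abbrev ConfigurationSpace (X : ConeGraph k V E) (len : E → ℝ) (S : Set E) : Type _ :=
  Quotient (X.congruent len S)

/-- A realization is rigid if it is isolated in the configuration space. -/
def IsRigid (X : ConeGraph k V E) (len : E → ℝ) (S : Set E)
    (p : X.realizationSpace len S) : Prop :=
  IsOpen ({Quotient.mk (X.congruent len S) p} : Set (X.ConfigurationSpace len S))

/-- A realization of the whole framework, as a realization of the framework with fewer bars. -/
def restrict (X : ConeGraph k V E) (len : E → ℝ) (S : Set E)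
    (p : X.realizationSpace len Set.univ) : X.realizationSpace len S :=
  ⟨p.1, p.2.1, fun e _ => p.2.2 e (Set.mem_univ e)⟩

/-- Rigid, but no longer rigid after the removal of any orbit of bars. -/
def IsMinimallyRigid (X : ConeGraph k V E) (len : E → ℝ)
    (p : X.realizationSpace len Set.univ) : Prop :=
  X.IsRigid len Set.univ p ∧
    ∀ e : E, ¬ X.IsRigid len (AddAction.orbit (ZMod k) e)ᶜ
      (X.restrict len (AddAction.orbit (ZMod k) e)ᶜ p)

/-- The infinitesimal rigidity system at the point configuration `p`: the unknown is an equivariant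
velocity assignment `q`, and the edge `ij` contributes the linear form `⟪p j - p i, q j - q i⟫`. -/
noncomputable def rigidityMap (X : ConeGraph k V E) (p : V → ℂ) : equivariantMaps k V →ₗ[ℝ] (E → ℝ) where
  toFun q := fun e => Sym2.lift ⟨fun i j => inner ℝ (p j - p i) (q.1 j - q.1 i), fun i j => by
    change inner ℝ (p j - p i) (q.1 j - q.1 i) = inner ℝ (p i - p j) (q.1 i - q.1 j)
    rw [← neg_sub (p i), ← neg_sub (q.1 i), inner_neg_neg]⟩ (X.ends e)
  map_add' q r := by
    funext e
    induction h : X.ends e using Sym2.ind with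
    | _ i j => simp only [Pi.add_apply, h, Sym2.lift_mk, Submodule.coe_add, ← inner_add_right,
        add_sub_add_comm]
  map_smul' c q := by
    funext e
    induction h : X.ends e using Sym2.ind with
    | _ i j => simp only [Pi.smul_apply, h, Sym2.lift_mk, Submodule.coe_smul, ← smul_sub,
        inner_smul_right, RingHom.id_apply, smul_eq_mul]

/-- The rank of the infinitesimal rigidity system at `p`. -/
noncomputable def rigidityRank (X : ConeGraph k V E) (p : V → ℂ) : ℕ :=
  Module.finrank ℝ (LinearMap.range (X.rigidityMap p))

/-- A realization `p` is generic if the rank of the infinitesimal rigidity system at `p` is maximal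
over all realizations of all frameworks (with any positive lengths) on the same graph. -/
def IsGeneric (X : ConeGraph k V E) (p : V → ℂ) : Prop :=
  ∀ len' : E → ℝ, (∀ e, 0 < len' e) → ∀ q ∈ X.realizationSpace len' Set.univ,
    X.rigidityRank q ≤ X.rigidityRank p

end ConeGraph

/-! ### Colored graphs -/

/-- A directed multigraph with vertex set `V` and edge set `E`, whose edges are colored by elements
of `Γ`. Loops and parallel edges are allowed. -/
structure ColoredGraph (Γ V E : Type*) where
  tail : E → V
  head : E → V
  color : E → Γ

namespace ColoredGraph

variable {Γ V E : Type*} [AddCommGroup Γ]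

/-- A subgraph: a set of vertices and a set of edges with both endpoints in it. -/
structure Subgraph (G : ColoredGraph Γ V E) where
  verts : Set V
  edges : Set E
  tail_mem : ∀ e ∈ edges, G.tail e ∈ verts
  head_mem : ∀ e ∈ edges, G.head e ∈ verts

/-- `G.HasWalk S a b g`: there is a (not necessarily simple) walk from `a` to `b` that uses only
edges in `S`, crossed in either direction, such that the sum of the colors of its edges, with a
minus sign where an edge is crossed backwards, equals `g`. -/
inductive HasWalk (G : ColoredGraph Γ V E) (S : Set E) : V → V → Γ → Prop
  | nil (a : V) : HasWalk G S a a 0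
  | forward {a : V} {g : Γ} (e : E) (he : e ∈ S) (h : HasWalk G S a (G.tail e) g) :
      HasWalk G S a (G.head e) (g + G.color e)
  | backward {a : V} {g : Γ} (e : E) (he : e ∈ S) (h : HasWalk G S a (G.head e) g) :
      HasWalk G S a (G.tail e) (g - G.color e)

theorem HasWalk.append {G : ColoredGraph Γ V E} {S : Set E} {a b c : V} {g h : Γ}
    (w : G.HasWalk S a b g) (w' : G.HasWalk S b c h) : G.HasWalk S a c (g + h) := by
  induction w' with
  | nil => simpa using w
  | forward e he _ ih => rw [← add_assoc]; exact ih.forward e he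
  | backward e he _ ih => rw [← add_sub_assoc]; exact ih.backward e he

theorem HasWalk.reverse {G : ColoredGraph Γ V E} {S : Set E} {a b : V} {g : Γ}
    (w : G.HasWalk S a b g) : G.HasWalk S b a (-g) := by
  induction w with
  | nil => simpa using HasWalk.nil _
  | forward e he _ ih =>
    have h := ((HasWalk.nil (G := G) (S := S) (G.head e)).backward e he).append ih
    rwa [zero_sub, ← neg_add_rev] at h
  | backward e he _ ih =>
    have h := ((HasWalk.nil (G := G) (S := S) (G.tail e)).forward e he).append ih
    rwa [zero_add, ← sub_eq_add_neg, ← neg_sub] at h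

/-- The image of the fundamental group, based at `b`, of the graph with edge set `S` under the map
`ρ` that sends a closed walk to its signed sum of colors. -/
def rhoImage (G : ColoredGraph Γ V E) (S : Set E) (b : V) : AddSubgroup Γ where
  carrier := {g | G.HasWalk S b b g}
  add_mem' := HasWalk.append
  zero_mem' := HasWalk.nil b
  neg_mem' := HasWalk.reverse

/-- Two vertices of a subgraph are related if they are joined by a walk in the subgraph. -/
def Subgraph.connected {G : ColoredGraph Γ V E} (H : G.Subgraph) : Setoid H.verts where
  r a b := ∃ g, G.HasWalk H.edges a b g
  iseqv :=
    { refl := fun _ => ⟨0, HasWalk.nil _⟩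
      symm := fun ⟨_, w⟩ => ⟨_, w.reverse⟩
      trans := fun ⟨_, w⟩ ⟨_, w'⟩ => ⟨_, w.append w'⟩ }

/-- The connected components of a subgraph (isolated vertices included). -/
abbrev Subgraph.Component {G : ColoredGraph Γ V E} (H : G.Subgraph) : Type _ :=
  Quotient H.connected

open Classical in
/-- The quantity `T` of a group of rotations: `0` if there is a nontrivial rotation in it,
and `2` otherwise. -/
noncomputable def rotationT (Δ : AddSubgroup Γ) : ℤ :=
  if ∃ g ∈ Δ, g ≠ 0 then 0 else 2

/-- `T` of a connected component, computed at some base vertex of the component (it does not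
depend on the base vertex, as `Γ` is commutative). -/
noncomputable def Subgraph.componentT {G : ColoredGraph Γ V E} (H : G.Subgraph)
    (c : H.Component) : ℤ :=
  rotationT (G.rhoImage H.edges (c.out : H.verts))

/-- Cone-Laman graphs. The sparsity condition ranges over all subgraphs with at least one edge. -/
def IsConeLaman (G : ColoredGraph Γ V E) : Prop :=
  (Nat.card E : ℤ) = 2 * Nat.card V - 1 ∧
    ∀ H : G.Subgraph, H.edges.Nonempty →
      (H.edges.ncard : ℤ) ≤ 2 * H.verts.ncard - 1 - ∑ᶠ c : H.Component, H.componentT c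

end ColoredGraph

/-! ### The colored quotient -/

/-- The set of orbits of the action of `ZMod k`. -/
abbrev ConeOrbits (k : ℕ) (A : Type*) [AddAction (ZMod k) A] : Type _ :=
  AddAction.orbitRel.Quotient (ZMod k) A

/-- `X.IsColoredQuotient G`: the colored graph `G`, whose vertices and edges are the orbits of the
vertices and of the edges of `X`, arises from `X` by a choice of a representative `rep o` of each
vertex orbit `o` and of an orientation of each edge orbit: the edge of `G` from `a` to `b`
with color `γ` is the orbit of an edge with endpoints `rep a` and `γ • rep b`. -/
def ConeGraph.IsColoredQuotient {k : ℕ} {V E : Type*} [AddAction (ZMod k) V]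
    [AddAction (ZMod k) E] (X : ConeGraph k V E)
    (G : ColoredGraph (ZMod k) (ConeOrbits k V) (ConeOrbits k E)) : Prop :=
  ∃ rep : ConeOrbits k V → V,
    (∀ o, Quotient.mk (AddAction.orbitRel (ZMod k) V) (rep o) = o) ∧
    ∀ o : ConeOrbits k E, ∃ e : E, Quotient.mk (AddAction.orbitRel (ZMod k) E) e = o ∧
      X.ends e = s(rep (G.tail o), G.color o +ᵥ rep (G.head o))

/-!
A configuration is determined by the positions `x` of the representatives of the vertex orbits, so
that the configurations form a real space of dimension `2n`. The edge orbits then contribute one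
plane of linear forms each, the plane `A e` of all forms that factor through the edge vector
`G.edgeVec e`, and the rigidity form `G.barForm` picks one form from each of these planes: the row
of `e` at `x` spans the intersection of `A e` with the hyperplane of all forms that vanish on the
infinitesimal rotation `I • x`.

*Dimension count.* For a set `F` of edges, the sum of the planes `A e` has codimension the
dimension of the space of configurations in which all edges in `F` collapse. A component
contributes `2` to the latter if all its closed walks have color sum zero, and `0` otherwise, that
is, it contributes `T` (`ColoredGraph.Subgraph.finrank_collapsed`). So the sparsity condition says
that `|F| + 1` is at most the dimension of the sum of the planes.

*Independence.* If the rows are independent at a configuration without collapsed edges, then this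
count holds, since the rows of `F` all lie in a proper subspace of the sum of the planes
(`ColoredGraph.card_edges_add_finrank_collapsed_lt`). Conversely the count is exactly the condition
in Lovász's theorem on the Dilworth truncation: a generic hyperplane then meets the planes in
independent lines (`exists_generic_hyperplane`), and, as every hyperplane belongs to some `I • x`,
this yields a configuration with independent rows and without collapsed edges. The theorem is proved
by choosing a sufficiently generic transversal of the planes greedily and then any generic hyperplane
through it.

*Rigidity.* If the rotation spans the infinitesimal motions, then the framework is rigid, because
for two realizations `x`, `y` the difference `y - x` is an infinitesimal motion of the midpoint
(`eventually_sub_mem_span_of_ker_le`). If the rank is locally maximal, then every infinitesimal motion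
is tangent to a motion (`exists_curve_in_fiber_of_rank_le`), and a motion through congruent
configurations is tangent to the rotation (`mem_span_I_smul_of_hasDerivAt`). Hence a generic
realization is rigid if and only if its rank is `2n - 1`, and minimally rigid if and only if,
moreover, the rows are independent.
-/

open Module Filter Topology

open scoped ComplexConjugate

/-! ### Generic vectors in subspaces and a generic hyperplane -/

/-- Prime avoidance for subspaces over an infinite field. -/
theorem Submodule.exists_mem_forall_notMem_of_not_le {K W ι : Type*} [Field K] [Infinite K]
    [AddCommGroup W] [Module K W] [Finite ι] (P : Submodule K W) (U : ι → Submodule K W)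
    (h : ∀ i, ¬ P ≤ U i) : ∃ x ∈ P, ∀ i, x ∉ U i := by
  by_contra! hx
  have hcover : ⋃ i, (((U i).comap P.subtype : Submodule K P) : Set P) = Set.univ := by
    refine Set.eq_univ_of_forall fun x => ?_
    obtain ⟨i, hi⟩ := hx x x.2
    exact Set.mem_iUnion.2 ⟨i, hi⟩
  obtain ⟨i, hi⟩ := Subspace.exists_eq_top_of_iUnion_eq_univ hcover
  exact h i (Submodule.comap_subtype_eq_top.1 hi)

/-- One vector `x e` is chosen from each `A e`, greedily and as generic as possible. Once the
vectors with index in `s` have been chosen, the sum of the spaces `A e` with `e ∈ F` loses no more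
dimension than it must, even if one index `f ∈ F` still counts with the whole space `A f`. -/
theorem exists_generic_vectors_aux {K W ι : Type*} [Field K] [Infinite K] [AddCommGroup W]
    [Module K W] [FiniteDimensional K W] [Finite ι] [DecidableEq ι] (A : ι → Submodule K W)
    (h : ∀ F : Finset ι, F.Nonempty →
      F.card + 1 ≤ finrank K (⨆ e ∈ F, A e : Submodule K W)) (s : Finset ι) :
    ∃ x : ι → W, (∀ e, x e ∈ A e) ∧ (∀ e ∈ s, x e ≠ 0) ∧ ∀ (f : ι) (F : Finset ι), f ∈ F →
      F.card + 1 ≤ finrank K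
        (A f ⊔ ⨆ e ∈ F, if e ∈ s then K ∙ x e else A e : Submodule K W) := by
  induction s using Finset.induction_on with
  | empty =>
    refine ⟨0, fun e => (A e).zero_mem, by simp, fun f F hf => (h F ⟨f, hf⟩).trans ?_⟩
    exact Submodule.finrank_mono (by simp)
  | insert a s ha ih =>
    obtain ⟨x, hxA, hx0, hx⟩ := ih
    let C : ι → Submodule K W := fun e => if e ∈ s then K ∙ x e else A e
    let U : ι × Finset ι → Submodule K W := fun fF => A fF.1 ⊔ ⨆ e ∈ fF.2, C e
    obtain ⟨y, hyA, hy⟩ := (A a).exists_mem_forall_notMem_of_not_le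
      (fun i : Option {fF // ¬ A a ≤ U fF} => i.elim ⊥ fun fF => U fF) (fun i => by
        cases i with
        | none =>
          intro hbot
          have := h {a} (Finset.singleton_nonempty a)
          rw [Finset.iSup_singleton, le_bot_iff.1 hbot, finrank_bot, Finset.card_singleton] at this
          omega
        | some i => exact i.2)
    have hy0 : y ≠ 0 := fun h0 => hy none (by simp [h0])
    replace hy := fun i => hy (some i)
    let C' : ι → Submodule K W := fun e =>
      if e ∈ insert a s then K ∙ Function.update x a y e else A e
    have hC' : ∀ e, e ≠ a → C' e = C e := by
      intro e he
      simp [C', C, he]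
    have hC'a : C' a = K ∙ y := by simp [C']
    have hCa : C a = A a := by simp [C, ha]
    refine ⟨Function.update x a y, fun e => ?_, fun e he => ?_, fun f F hf => ?_⟩
    · by_cases he : e = a
      · subst he; simpa using hyA
      · simpa [he] using hxA e
    · by_cases hea : e = a
      · subst hea; simpa using hy0
      · simpa [hea] using hx0 e (Finset.mem_of_mem_insert_of_ne he hea)
    change F.card + 1 ≤ finrank K (A f ⊔ ⨆ e ∈ F, C' e : Submodule K W)
    have hold : F.card + 1 ≤ finrank K (A f ⊔ ⨆ e ∈ F, C e : Submodule K W) := hx f F hf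
    by_cases haF : a ∈ F
    · by_cases hfa : f = a
      · -- the whole of `A a` is present, so nothing is lost
        subst hfa
        refine hold.trans (Submodule.finrank_mono (sup_le le_sup_left (iSup₂_le fun e he => ?_)))
        by_cases hef : e = f
        · rw [hef, hCa]; exact le_sup_left
        · rw [← hC' e hef]
          exact le_sup_of_le_right (le_iSup₂_of_le e he le_rfl)
      · have hfF : f ∈ F.erase a := Finset.mem_erase.2 ⟨hfa, hf⟩
        have hU := hx f (F.erase a) hfF
        change (F.erase a).card + 1 ≤ finrank K (U (f, F.erase a)) at hU
        have hcard := Finset.card_erase_add_one haF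
        have hUle : U (f, F.erase a) ≤ A f ⊔ ⨆ e ∈ F, C' e := by
          refine sup_le_sup_left (iSup₂_le fun e he => ?_) _
          rw [← hC' e (Finset.ne_of_mem_erase he)]
          exact le_iSup₂_of_le e (Finset.mem_of_mem_erase he) le_rfl
        by_cases hAU : A a ≤ U (f, F.erase a)
        · refine hold.trans (Submodule.finrank_mono (le_trans ?_ hUle))
          refine sup_le le_sup_left (iSup₂_le fun e he => ?_)
          by_cases hea : e = a
          · rw [hea, hCa]; exact hAU
          · exact le_sup_of_le_right
              (le_iSup₂_of_le e (Finset.mem_erase.2 ⟨hea, he⟩) le_rfl)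
        · -- `y` lies outside `U (f, F.erase a)`, so it raises the dimension by one
          have hlt : U (f, F.erase a) < A f ⊔ ⨆ e ∈ F, C' e := by
            refine lt_of_le_of_ne hUle fun heq => hy ⟨_, hAU⟩ ?_
            change y ∈ U (f, F.erase a)
            rw [heq]
            have : K ∙ y ≤ A f ⊔ ⨆ e ∈ F, C' e :=
              le_sup_of_le_right (le_iSup₂_of_le a haF hC'a.ge)
            exact this (Submodule.mem_span_singleton_self y)
          have := Submodule.finrank_lt_finrank_of_lt hlt
          omega
    · refine hold.trans (Submodule.finrank_mono (sup_le_sup_left (iSup₂_le fun e he => ?_) _))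
      rw [← hC' e (fun hea => haF (hea ▸ he))]
      exact le_iSup₂_of_le e he le_rfl

/-- A strengthening of Rado's theorem on independent transversals, for planes: if the count holds
with one unit to spare, then there is a transversal whose span contains none of the planes. -/
theorem exists_linearIndependent_transversal {K W ι : Type*} [Field K] [Infinite K]
    [AddCommGroup W] [Module K W] [FiniteDimensional K W] [Finite ι] (A : ι → Submodule K W)
    (hA : ∀ e, finrank K (A e) ≤ 2)
    (h : ∀ F : Finset ι, F.Nonempty →
      F.card + 1 ≤ finrank K (⨆ e ∈ F, A e : Submodule K W)) :
    ∃ x : ι → W, (∀ e, x e ∈ A e) ∧ LinearIndependent K x ∧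
      ∀ f, ¬ A f ≤ Submodule.span K (Set.range x) := by
  classical
  have := Fintype.ofFinite ι
  obtain ⟨x, hxA, hx0, hx⟩ := exists_generic_vectors_aux A h Finset.univ
  have hspan : (⨆ e ∈ Finset.univ, if e ∈ Finset.univ then K ∙ x e else A e : Submodule K W)
      = Submodule.span K (Set.range x) := by
    simp [Submodule.span_range_eq_iSup]
  have key : ∀ f, Fintype.card ι + 1 ≤
      finrank K (A f ⊔ Submodule.span K (Set.range x) : Submodule K W) := by
    intro f
    have := hx f Finset.univ (Finset.mem_univ f)
    rwa [hspan, Finset.card_univ] at this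
  refine ⟨x, hxA, ?_, fun f hf => ?_⟩
  · rw [linearIndependent_iff_card_le_finrank_span]
    by_cases hι : Nonempty ι
    · obtain ⟨f⟩ := hι
      have h1 := Submodule.finrank_sup_add_finrank_inf_eq (A f) (Submodule.span K (Set.range x))
      have h2 := key f
      have h3 := hA f
      have h4 : (Set.range x).finrank K = finrank K (Submodule.span K (Set.range x)) := rfl
      have : 1 ≤ finrank K (A f ⊓ Submodule.span K (Set.range x) : Submodule K W) := by
        rw [Nat.one_le_iff_ne_zero, Ne, Submodule.finrank_eq_zero]
        intro hbot
        exact hx0 f (Finset.mem_univ f) ((Submodule.mem_bot K).1 (hbot ▸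
          ⟨hxA f, Submodule.subset_span ⟨f, rfl⟩⟩))
      omega
    · rw [not_nonempty_iff] at hι
      simp
  · have h1 := key f
    rw [sup_eq_right.2 hf] at h1
    have := finrank_range_le_card (R := K) x
    change finrank K (Submodule.span K (Set.range x)) ≤ _ at this
    omega

/-- A linearly independent finite family of linear forms takes all systems of values. -/
theorem LinearIndependent.surjective_pi_dual {K V ι : Type*} [Field K] [AddCommGroup V]
    [Module K V] [Finite ι] {x : ι → Dual K V} (hx : LinearIndependent K x) :
    Function.Surjective (LinearMap.pi x : V →ₗ[K] ι → K) := by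
  classical
  have := Fintype.ofFinite ι
  rw [← LinearMap.range_eq_top]
  by_contra hne
  obtain ⟨f, hf0, hf⟩ := Submodule.exists_le_ker_of_lt_top _ (lt_top_iff_ne_top.2 hne)
  refine hf0 ((LinearMap.pi_ext' fun i => LinearMap.ext_ring ?_))
  have hsingle : ∀ i : ι, (fun j => if i = j then (1 : K) else 0) = Pi.single i 1 := fun i => by
    ext j
    simp [Pi.single_apply, eq_comm]
  have hsum : ∑ i, f (Pi.single i 1) • x i = 0 := by
    ext v
    have hv : f (LinearMap.pi x v) = 0 := hf ⟨v, rfl⟩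
    rw [LinearMap.pi_apply_eq_sum_univ f] at hv
    simpa [mul_comm, hsingle] using hv
  simpa using Fintype.linearIndependent_iff.1 hx _ hsum i

/-- Lovász's theorem on the Dilworth truncation, for the planes `A e = range (D e).dualMap` in the
dual space of `V`: under the count, some vector `z`, seen as a hyperplane in the dual space, meets
the planes in lines that are linearly independent. The hyperplane is any generic one through an
independent transversal whose span contains none of the planes. -/
theorem exists_generic_hyperplane {K V Y ι : Type*} [Field K] [Infinite K] [AddCommGroup V]
    [Module K V] [FiniteDimensional K V] [AddCommGroup Y] [Module K Y] [FiniteDimensional K Y]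
    [Finite ι] (hY : finrank K Y ≤ 2) (D : ι → V →ₗ[K] Y)
    (h : ∀ F : Finset ι, F.Nonempty →
      F.card + 1 + finrank K (⨅ e ∈ F, LinearMap.ker (D e) : Submodule K V) ≤ finrank K V) :
    ∃ z : V, (∀ e, D e z ≠ 0) ∧ ∃ l : ι → Dual K Y, (∀ e, l e (D e z) = 0) ∧
      LinearIndependent K fun e => l e ∘ₗ D e := by
  obtain ⟨x, hxA, hx, hxspan⟩ := exists_linearIndependent_transversal
    (fun e => LinearMap.range (D e).dualMap)
    (fun e => ((D e).dualMap.finrank_range_le).trans (by rwa [Subspace.dual_finrank_eq]))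
    (fun F hF => by
      have h1 : (⨆ e ∈ F, LinearMap.range (D e).dualMap) =
          (⨅ e ∈ F, LinearMap.ker (D e)).dualAnnihilator := by
        simp_rw [LinearMap.range_dualMap_eq_dualAnnihilator_ker, iInf_subtype',
          iSup_subtype', Subspace.dualAnnihilator_iInf_eq]
      have h2 := Subspace.finrank_add_finrank_dualAnnihilator_eq (⨅ e ∈ F, LinearMap.ker (D e))
      have h3 := h F hF
      rw [h1]
      omega)
  choose l hl using hxA
  obtain ⟨z, hz, hzD⟩ := (Submodule.span K (Set.range x)).dualCoannihilator
      |>.exists_mem_forall_notMem_of_not_le (fun e => LinearMap.ker (D e)) (fun e he => by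
    refine hxspan e ?_
    rw [LinearMap.range_dualMap_eq_dualAnnihilator_ker]
    refine (Submodule.dualAnnihilator_anti he).trans ?_
    rw [Subspace.dualCoannihilator_dualAnnihilator_eq])
  refine ⟨z, fun e he => hzD e he, l, fun e => ?_, ?_⟩
  · have : x e z = 0 := (Submodule.mem_dualCoannihilator _).1 hz _ (Submodule.subset_span ⟨e, rfl⟩)
    rwa [← hl e] at this
  · have : LinearIndependent K fun e => (D e).dualMap (l e) := by simpa only [hl] using hx
    exact this

/-! ### Closed walks and the configurations in which all edges collapse -/

namespace ColoredGraph

variable {k : ℕ} {Γ N M : Type*}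

/-- The configurations of a subgraph, as configurations that vanish at all other vertices. -/
def Subgraph.configurations {G : ColoredGraph Γ N M} (H : G.Subgraph) :
    Submodule ℝ (N → ℂ) where
  carrier := {x | ∀ v, v ∉ H.verts → x v = 0}
  add_mem' hx hy v hv := by simp [hx v hv, hy v hv]
  zero_mem' v _ := rfl
  smul_mem' c x hx v hv := by simp [hx v hv]

theorem Subgraph.finrank_configurations [Finite N] {G : ColoredGraph Γ N M}
    (H : G.Subgraph) : finrank ℝ H.configurations = 2 * H.verts.ncard := by
  classical
  have := Fintype.ofFinite N
  have := Fintype.ofFinite H.verts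
  let f : H.configurations →ₗ[ℝ] (H.verts → ℂ) :=
    LinearMap.pi fun v => LinearMap.proj (v : N) ∘ₗ H.configurations.subtype
  have hf : Function.Bijective f := by
    refine ⟨fun x y hxy => Subtype.ext (funext fun v => ?_), fun z => ?_⟩
    · by_cases hv : v ∈ H.verts
      · exact congrFun hxy ⟨v, hv⟩
      · rw [x.2 v hv, y.2 v hv]
    · refine ⟨⟨fun v => if hv : v ∈ H.verts then z ⟨v, hv⟩ else 0, fun v hv => dif_neg hv⟩, ?_⟩
      funext v
      exact dif_pos v.2
  rw [(LinearEquiv.ofBijective f hf).finrank_eq, finrank_pi_fintype]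
  simp only [Complex.finrank_real_complex, Finset.sum_const, Finset.card_univ, smul_eq_mul]
  rw [mul_comm, ← Nat.card_eq_fintype_card, Nat.card_coe_set_eq]

variable [NeZero k]

/-- A configuration of the colored graph assigns to each vertex orbit the position of its
representative. For an edge orbit `e`, this is the difference of the end positions of one edge in
the orbit, as a linear function of the configuration. -/
noncomputable def edgeVec (G : ColoredGraph (ZMod k) N M) (e : M) : (N → ℂ) →ₗ[ℝ] ℂ where
  toFun x := ZMod.stdAddChar (G.color e) * x (G.head e) - x (G.tail e)
  map_add' x y := by
    simp only [Pi.add_apply]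
    ring
  map_smul' c x := by
    simp only [Pi.smul_apply, Complex.real_smul, RingHom.id_apply]
    ring

theorem edgeVec_apply (G : ColoredGraph (ZMod k) N M) (e : M) (x : N → ℂ) :
    G.edgeVec e x = ZMod.stdAddChar (G.color e) * x (G.head e) - x (G.tail e) := rfl

theorem edgeVec_smul (G : ColoredGraph (ZMod k) N M) (e : M) (c : ℂ) (x : N → ℂ) :
    G.edgeVec e (c • x) = c * G.edgeVec e x := by
  simp only [edgeVec_apply, Pi.smul_apply, smul_eq_mul]
  ring

theorem HasWalk.eq_stdAddChar_mul {G : ColoredGraph (ZMod k) N M} {S : Set M} {x : N → ℂ}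
    (hx : ∀ e ∈ S, G.edgeVec e x = 0) {a b : N} {g : ZMod k} (w : G.HasWalk S a b g) :
    x a = ZMod.stdAddChar g * x b := by
  induction w with
  | nil => simp
  | forward e he _ ih =>
    have h := hx e he
    rw [edgeVec_apply, sub_eq_zero] at h
    rw [ih, ← h, AddChar.map_add_eq_mul, mul_assoc]
  | backward e he _ ih =>
    have h := hx e he
    rw [edgeVec_apply, sub_eq_zero] at h
    rw [ih, ← h, ← mul_assoc, ← AddChar.map_add_eq_mul, sub_add_cancel]

/-- The configurations of a subgraph in which every edge has length zero. -/
noncomputable def Subgraph.collapsed {G : ColoredGraph (ZMod k) N M} (H : G.Subgraph) :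
    Submodule ℝ (N → ℂ) :=
  H.configurations ⊓ ⨅ e ∈ H.edges, LinearMap.ker (G.edgeVec e)

theorem Subgraph.mem_collapsed {G : ColoredGraph (ZMod k) N M} {H : G.Subgraph} {x : N → ℂ} :
    x ∈ H.collapsed ↔ (∀ v, v ∉ H.verts → x v = 0) ∧ ∀ e ∈ H.edges, G.edgeVec e x = 0 := by
  simp [collapsed, configurations, Submodule.mem_iInf]

/-- A collapsed configuration is determined, on each component, by its value at a base point. This
value is arbitrary when all closed walks in the component have color sum `0`, and it is `0`
otherwise, because a nontrivial rotation fixes only the origin. -/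
theorem Subgraph.finrank_collapsed [Finite N] {G : ColoredGraph (ZMod k) N M} (H : G.Subgraph) :
    (finrank ℝ H.collapsed : ℤ) = ∑ᶠ c : H.Component, H.componentT c := by
  classical
  have := Fintype.ofFinite N
  have := Fintype.ofFinite H.verts
  have : Finite H.Component := Quotient.finite _
  have := Fintype.ofFinite H.Component
  let U : H.Component → Submodule ℝ ℂ := fun c =>
    if ∃ g ∈ G.rhoImage H.edges (c.out : H.verts), g ≠ 0 then ⊥ else ⊤
  have hU : ∀ c, (finrank ℝ (U c) : ℤ) = H.componentT c := by
    intro c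
    by_cases hc : ∃ g ∈ G.rhoImage H.edges (c.out : H.verts), g ≠ 0
    · rw [show U c = ⊥ from if_pos hc, componentT, rotationT, if_pos hc, finrank_bot]
      rfl
    · rw [show U c = ⊤ from if_neg hc, componentT, rotationT, if_neg hc, finrank_top,
        Complex.finrank_real_complex]
      rfl
  have hmem : ∀ (c : H.Component) (x : H.collapsed), x.1 (c.out : H.verts) ∈ U c := by
    intro c x
    simp only [U]
    split_ifs with hc
    · obtain ⟨g, hg, hg0⟩ := hc
      have h := HasWalk.eq_stdAddChar_mul (mem_collapsed.1 x.2).2 hg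
      rw [Submodule.mem_bot]
      by_contra hx0
      have h1 : ZMod.stdAddChar g = (1 : ℂ) := (mul_eq_right₀ hx0).1 h.symm
      rw [← AddChar.map_zero_eq_one (ZMod.stdAddChar (N := k))] at h1
      exact hg0 (ZMod.injective_stdAddChar h1)
    · trivial
  let f : H.collapsed →ₗ[ℝ] ∀ c, U c := LinearMap.pi fun c =>
    (LinearMap.proj (c.out : H.verts).1 ∘ₗ H.collapsed.subtype).codRestrict (U c) (hmem c)
  -- a walk from the base point of the component of `v` to `v`
  have hwalk : ∀ v : H.verts, ∃ g,
      G.HasWalk H.edges ((Quotient.mk H.connected v).out : H.verts) v g :=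
    fun v => Quotient.mk_out (s := H.connected) v
  have hf : Function.Bijective f := by
    refine ⟨fun x y hxy => Subtype.ext (funext fun v => ?_), fun z => ?_⟩
    · by_cases hv : v ∈ H.verts
      · obtain ⟨g, hg⟩ := hwalk ⟨v, hv⟩
        have h1 := HasWalk.eq_stdAddChar_mul (mem_collapsed.1 x.2).2 hg.reverse
        have h2 := HasWalk.eq_stdAddChar_mul (mem_collapsed.1 y.2).2 hg.reverse
        have h3 := congrArg Subtype.val (congrFun hxy (Quotient.mk H.connected ⟨v, hv⟩))
        exact h1.trans ((congrArg _ h3).trans h2.symm)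
      · rw [(mem_collapsed.1 x.2).1 v hv, (mem_collapsed.1 y.2).1 v hv]
    · choose g hg using hwalk
      -- the sum of the colors along a closed walk does not matter where `z` is nonzero
      have hclosed : ∀ (c : H.Component) (a : ZMod k),
          G.HasWalk H.edges (c.out : H.verts) (c.out : H.verts) a →
          ZMod.stdAddChar a * (z c : ℂ) = z c := by
        intro c a ha
        by_cases ha0 : a = 0
        · simp [ha0]
        · have hbot : U c = ⊥ := if_pos ⟨a, ha, ha0⟩
          have hz : (z c : ℂ) ∈ (⊥ : Submodule ℝ ℂ) := hbot ▸ (z c).2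
          rw [(Submodule.mem_bot ℝ).1 hz, mul_zero]
      let x : N → ℂ := fun v => if hv : v ∈ H.verts then
        ZMod.stdAddChar (-g ⟨v, hv⟩) * z (Quotient.mk H.connected ⟨v, hv⟩) else 0
      have hx : x ∈ H.collapsed := by
        refine mem_collapsed.2 ⟨fun v hv => dif_neg hv, fun e he => ?_⟩
        have ht := H.tail_mem e he
        have hh := H.head_mem e he
        have hmk : Quotient.mk H.connected ⟨G.head e, hh⟩ = Quotient.mk H.connected
            ⟨G.tail e, ht⟩ :=
          Quotient.sound ⟨_, (HasWalk.nil _).backward e he⟩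
        have hw1 := (hg ⟨G.tail e, ht⟩).forward e he
        have hw2 := (hg ⟨G.head e, hh⟩).reverse
        rw [hmk] at hw2
        have h := hclosed _ _ (hw1.append hw2)
        rw [edgeVec_apply, sub_eq_zero]
        simp only [x, dif_pos ht, dif_pos hh]
        rw [hmk]
        nth_rewrite 2 [← h]
        rw [← mul_assoc, ← mul_assoc, ← AddChar.map_add_eq_mul, ← AddChar.map_add_eq_mul]
        congr 2
        abel
      refine ⟨⟨x, hx⟩, funext fun c => Subtype.ext ?_⟩
      change x (c.out : H.verts) = z c
      have hmk : Quotient.mk H.connected c.out = c := Quotient.out_eq c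
      have hw := hg c.out
      rw [hmk] at hw
      have h := hclosed c _ hw.reverse
      simp only [x, dif_pos c.out.2]
      rw [← h]
      exact congrArg _ (congrArg (fun c => (z c : ℂ)) hmk)
  rw [(LinearEquiv.ofBijective f hf).finrank_eq, finrank_pi_fintype, finsum_eq_sum_of_fintype]
  push_cast
  exact Finset.sum_congr rfl fun c _ => hU c

end ColoredGraph

/-! ### Rigidity of the fibres of a smooth map and of a quadratic map -/

/-- Where the rank of the derivative is locally maximal, every vector in the kernel of the
derivative is tangent to a curve in the fibre. The curve comes from the inverse function theorem,
applied to the components of `f` along the range of the derivative; the remaining components are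
constant on the curve, because near `x` the kernel of the derivative is determined by the
former. -/
theorem exists_curve_in_fiber_of_rank_le {E F : Type*} [NormedAddCommGroup E] [NormedSpace ℝ E]
    [FiniteDimensional ℝ E] [NormedAddCommGroup F] [NormedSpace ℝ F] [FiniteDimensional ℝ F]
    {f : E → F} (hf : ContDiff ℝ 1 f) {x : E}
    (hrank : ∀ᶠ y in 𝓝 x, finrank ℝ (LinearMap.range (fderiv ℝ f y).toLinearMap) ≤
      finrank ℝ (LinearMap.range (fderiv ℝ f x).toLinearMap))
    {w : E} (hw : fderiv ℝ f x w = 0) :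
    ∃ c : ℝ → E, c 0 = x ∧ HasDerivAt c w 0 ∧ ∀ᶠ t in 𝓝 0, f (c t) = f x := by
  have : CompleteSpace E := FiniteDimensional.complete ℝ E
  set L := fderiv ℝ f x with hL
  let R := LinearMap.range L.toLinearMap
  let Z := LinearMap.ker L.toLinearMap
  obtain ⟨P₀, hP₀⟩ := R.subtype.exists_leftInverse_of_injective R.ker_subtype
  obtain ⟨K₀, hK₀⟩ := Z.subtype.exists_leftInverse_of_injective Z.ker_subtype
  let P : F →L[ℝ] R := P₀.toContinuousLinearMap
  let K : E →L[ℝ] Z := K₀.toContinuousLinearMap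
  have hP : ∀ r : R, P r = r := fun r => LinearMap.congr_fun hP₀ r
  have hK : ∀ r : Z, K r = r := fun r => LinearMap.congr_fun hK₀ r
  let Φ : E → R × Z := fun y => (P (f y), K y)
  have hdf : ∀ y, HasFDerivAt f (fderiv ℝ f y) y := fun y =>
    (hf.differentiable one_ne_zero y).hasFDerivAt
  have hΦ : ContDiff ℝ 1 Φ := (P.contDiff.comp hf).prodMk K.contDiff
  have hinj : Function.Injective ((P ∘L L).prod K) := by
    rw [injective_iff_map_eq_zero]
    intro v hv
    obtain ⟨h1, h2⟩ := Prod.ext_iff.1 hv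
    have h3 : (⟨L v, v, rfl⟩ : R) = 0 := (hP ⟨L v, v, rfl⟩).symm.trans h1
    have h4 : v ∈ Z := congrArg Subtype.val h3
    exact congrArg Subtype.val ((hK ⟨v, h4⟩).symm.trans h2)
  have hdim : finrank ℝ E = finrank ℝ (R × Z) := by
    rw [finrank_prod]
    exact (LinearMap.finrank_range_add_finrank_ker L.toLinearMap).symm
  let e : E ≃L[ℝ] R × Z := (LinearEquiv.ofInjectiveOfFinrankEq
    ((P ∘L L).prod K).toLinearMap hinj hdim).toContinuousLinearEquiv
  have he : ∀ v, e v = (P (L v), K v) := fun v => rfl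
  have hΦ' : HasFDerivAt Φ (e : E →L[ℝ] R × Z) x :=
    (P.hasFDerivAt.comp x (hdf x)).prodMk K.hasFDerivAt
  have hΦx : ContDiffAt ℝ 1 Φ x := hΦ.contDiffAt
  let Ψ := hΦx.localInverse hΦ' one_ne_zero
  have hΨ : ContDiffAt ℝ 1 Ψ (Φ x) := hΦx.to_localInverse hΦ' one_ne_zero
  have hΨx : Ψ (Φ x) = x := hΦx.localInverse_apply_image hΦ' one_ne_zero
  have hΦΨ : ∀ᶠ z in 𝓝 (Φ x), Φ (Ψ z) = z :=
    (hΦx.hasStrictFDerivAt' hΦ' one_ne_zero).eventually_right_inverse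
  let wz : Z := ⟨w, hw⟩
  let b : ℝ → R × Z := fun t => Φ x + t • ((0, wz) : R × Z)
  have hb0 : b 0 = Φ x := by simp [b]
  have hbd : ∀ t, HasDerivAt b (0, wz) t := fun t => by
    simpa [b] using ((hasDerivAt_id t).smul_const ((0, wz) : R × Z)).const_add (Φ x)
  have hbc : Tendsto b (𝓝 0) (𝓝 (Φ x)) := hb0 ▸ (hbd 0).continuousAt.tendsto
  let c : ℝ → E := fun t => Ψ (b t)
  have hc0 : c 0 = x := by simp only [c, hb0, hΨx]
  have hdiff : ∀ᶠ t in 𝓝 0, DifferentiableAt ℝ c t := by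
    have h1 : ∀ᶠ z in 𝓝 (Φ x), ContDiffAt ℝ 1 Ψ z := hΨ.eventually (by simp)
    filter_upwards [hbc.eventually h1] with t ht
    exact (ht.differentiableAt one_ne_zero).comp t (hbd t).differentiableAt
  have hcc : Tendsto c (𝓝 0) (𝓝 x) := by
    have := hdiff.self_of_nhds.continuousAt.tendsto
    rwa [hc0] at this
  have hΦc : ∀ᶠ t in 𝓝 0, Φ (c t) = b t := hbc.eventually hΦΨ
  -- the derivative of `c` in terms of the derivative of `f`
  have hderiv : ∀ᶠ t in 𝓝 0, HasDerivAt c (deriv c t) t ∧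
      P (fderiv ℝ f (c t) (deriv c t)) = 0 ∧ K (deriv c t) = wz := by
    filter_upwards [hdiff, hΦc.eventually_nhds] with t ht hΦt
    have h1 : HasDerivAt (fun s => Φ (c s))
        (P (fderiv ℝ f (c t) (deriv c t)), K (deriv c t)) t :=
      ((P.hasFDerivAt.comp _ (hdf (c t))).prodMk K.hasFDerivAt).comp_hasDerivAt t ht.hasDerivAt
    have h2 := h1.unique ((hbd t).congr_of_eventuallyEq hΦt)
    exact ⟨ht.hasDerivAt, (Prod.ext_iff.1 h2).1, (Prod.ext_iff.1 h2).2⟩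
  have hker : ∀ᶠ y in 𝓝 x, ∀ v, P (fderiv ℝ f y v) = 0 → fderiv ℝ f y v = 0 := by
    have hinjP : ∀ᶠ y in 𝓝 x, Function.Injective ((P ∘L fderiv ℝ f y).prod K) := by
      have hcont : Continuous fun y => (P ∘L fderiv ℝ f y).prod K := by
        have := hf.continuous_fderiv one_ne_zero
        exact (ContinuousLinearMap.prodₗᵢ ℝ).continuous.comp
          (f := fun y => (P ∘L fderiv ℝ f y, K)) (by fun_prop)
      exact hcont.continuousAt.eventually (ContinuousLinearMap.isOpen_injective.mem_nhds hinj)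
    filter_upwards [hinjP, hrank] with y hy hry v hv
    -- the kernel of `P ∘ f'(y)` is not larger than that of `f'(y)`, by a dimension count
    let A : E →ₗ[ℝ] R := (P ∘L fderiv ℝ f y).toLinearMap
    let B : E →ₗ[ℝ] F := (fderiv ℝ f y).toLinearMap
    have hle : LinearMap.ker B ≤ LinearMap.ker A := fun u hu => by
      change P (fderiv ℝ f y u) = 0
      rw [show fderiv ℝ f y u = 0 from hu, map_zero]
    have hA : finrank ℝ (LinearMap.ker A) ≤ finrank ℝ Z := by
      refine LinearMap.finrank_le_finrank_of_injective
        (f := K.toLinearMap ∘ₗ (LinearMap.ker A).subtype) ?_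
      intro u₁ u₂ hu
      refine Subtype.ext (hy (Prod.ext ?_ hu))
      exact (show A u₁ = 0 from u₁.2).trans (show A u₂ = 0 from u₂.2).symm
    have hB := LinearMap.finrank_range_add_finrank_ker B
    have hL' := LinearMap.finrank_range_add_finrank_ker L.toLinearMap
    have heq : LinearMap.ker B = LinearMap.ker A := by
      refine Submodule.eq_of_le_of_finrank_le hle ?_
      change finrank ℝ (LinearMap.range B) ≤ finrank ℝ (LinearMap.range L.toLinearMap) at hry
      change finrank ℝ (LinearMap.ker A) ≤ finrank ℝ (LinearMap.ker L.toLinearMap) at hA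
      omega
    have : v ∈ LinearMap.ker B := heq ▸ hv
    exact this
  refine ⟨c, hc0, ?_, ?_⟩
  · obtain ⟨h1, h2, h3⟩ := hderiv.self_of_nhds
    convert h1
    rw [hc0] at h2
    refine e.injective ?_
    rw [he, he, hw, h3, map_zero]
    exact Prod.ext h2.symm (hK wz)
  · have hfc : ∀ᶠ t in 𝓝 0, HasDerivAt (fun s => f (c s)) 0 t := by
      filter_upwards [hderiv, hcc.eventually hker] with t ⟨h1, h2, _⟩ h4
      have := (hdf (c t)).comp_hasDerivAt t h1
      rwa [h4 _ h2] at this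
    obtain ⟨ε, hε, hball⟩ := Metric.eventually_nhds_iff_ball.1 hfc
    filter_upwards [Metric.ball_mem_nhds (0 : ℝ) hε] with t ht
    rw [← hc0]
    exact (convex_ball (0 : ℝ) ε).is_const_of_fderivWithin_eq_zero (𝕜 := ℝ)
      (f := fun s => f (c s)) (fun s hs => (hball s hs).differentiableAt.differentiableWithinAt)
      (fun s hs => by
        rw [fderivWithin_of_isOpen Metric.isOpen_ball hs]
        ext
        simpa using (hball s hs).deriv) ht (Metric.mem_ball_self hε)

/-- Infinitesimal rigidity implies rigidity. The form `B` being symmetric, `B x x = B y y` says that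
`y - x` lies in the kernel of `B (x + y)`, and for `y` near `x` this kernel is again spanned by the
trivial motion `J (x + y)`. -/
theorem eventually_sub_mem_span_of_ker_le {E F : Type*} [NormedAddCommGroup E] [NormedSpace ℝ E]
    [FiniteDimensional ℝ E] [NormedAddCommGroup F] [NormedSpace ℝ F] [FiniteDimensional ℝ F]
    (B : E →ₗ[ℝ] E →ₗ[ℝ] F) (hB : ∀ x y, B x y = B y x) (J : E →ₗ[ℝ] E)
    (hJ : ∀ x, B x (J x) = 0) {x : E} (hJx : J x ≠ 0) (hker : ∀ y, B x y = 0 → y ∈ ℝ ∙ J x) :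
    ∀ᶠ y in 𝓝 x, B y y = B x x → y - x ∈ ℝ ∙ J (x + y) := by
  obtain ⟨l, hl⟩ := SeparatingDual.exists_ne_zero (R := ℝ) hJx
  let B' : E →ₗ[ℝ] E →L[ℝ] F := LinearMap.toContinuousLinearMap.toLinearMap ∘ₗ B
  have hB' : Continuous B' := B'.continuous_of_finiteDimensional
  have hJc : Continuous J := J.continuous_of_finiteDimensional
  have hinj : Function.Injective ((B' (x + x)).prod l) := by
    rw [injective_iff_map_eq_zero]
    intro v hv
    obtain ⟨h1, h2⟩ := Prod.ext_iff.1 hv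
    have h3 : B (x + x) v = 0 := h1
    rw [map_add, LinearMap.add_apply, ← two_smul ℝ, smul_eq_zero] at h3
    obtain ⟨s, rfl⟩ := Submodule.mem_span_singleton.1 (hker v (h3.resolve_left two_ne_zero))
    have h4 : l (s • J x) = 0 := h2
    rw [map_smul, smul_eq_mul, mul_eq_zero] at h4
    rw [h4.resolve_right hl, zero_smul]
  have h1 : ∀ᶠ y in 𝓝 x, Function.Injective ((B' (x + y)).prod l) := by
    have hcont : Continuous fun y => (B' (x + y)).prod l :=
      (ContinuousLinearMap.prodₗᵢ ℝ).continuous.comp (f := fun y => (B' (x + y), l)) (by fun_prop)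
    exact hcont.continuousAt.eventually (ContinuousLinearMap.isOpen_injective.mem_nhds hinj)
  have h2 : ∀ᶠ y in 𝓝 x, l (J (x + y)) ≠ 0 := by
    have hcont : Continuous fun y => l (J (x + y)) := by fun_prop
    refine hcont.continuousAt.eventually_ne ?_
    rw [map_add, map_add, ← two_smul ℝ]
    simpa using hl
  filter_upwards [h1, h2] with y hy1 hy2 hy
  refine Submodule.mem_span_singleton.2 ⟨l (y - x) / l (J (x + y)), hy1 (Prod.ext ?_ ?_)⟩
  · have h3 : B (x + y) (y - x) = 0 := by
      simp only [map_add, map_sub, LinearMap.add_apply, hB y x, hy]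
      abel
    change B (x + y) (_ • J (x + y)) = B (x + y) (y - x)
    rw [map_smul, hJ, smul_zero, h3]
  · change l (_ • J (x + y)) = l (y - x)
    rw [map_smul, smul_eq_mul, div_mul_cancel₀ _ hy2]

/-! ### The rigidity form of a colored graph -/

theorem Complex.inner_I_mul_self (u : ℂ) : inner ℝ u (Complex.I * u) = 0 := by
  simp [Complex.inner]
  ring

/-- A linear form on the plane that vanishes at `u` is a multiple of the inner product with the
rotated vector. -/
theorem Complex.dual_apply_mul_of_apply_eq_zero (l : Dual ℝ ℂ) {u : ℂ} (hu : u ≠ 0)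
    (hl : l u = 0) (w : ℂ) :
    l w * ‖u‖ ^ 2 = l (Complex.I * u) * inner ℝ (Complex.I * u) w := by
  have hw : w = (w / u).re • u + (w / u).im • (Complex.I * u) := by
    rw [Complex.real_smul, Complex.real_smul, ← mul_assoc, ← add_mul, Complex.re_add_im,
      div_mul_cancel₀ w hu]
  have h1 : inner ℝ (Complex.I * u) (Complex.I * u) = ‖u‖ ^ 2 := by
    rw [real_inner_self_eq_norm_sq, norm_mul, Complex.norm_I, one_mul]
  have h2 : inner ℝ (Complex.I * u) u = 0 := by
    rw [real_inner_comm, Complex.inner_I_mul_self]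
  rw [hw, map_add, map_smul, map_smul, inner_add_right, inner_smul_right, inner_smul_right, hl,
    h1, h2]
  simp only [smul_eq_mul]
  ring

namespace ColoredGraph

variable {k : ℕ} [NeZero k] {N M : Type*}

/-- The rigidity form of the edges in `T`: at the configuration `x` and the velocity `y`, its value
at `e` is half the rate of change of the squared length of `e`. -/
noncomputable def barForm (G : ColoredGraph (ZMod k) N M) (T : Set M) :
    (N → ℂ) →ₗ[ℝ] (N → ℂ) →ₗ[ℝ] (T → ℝ) :=
  LinearMap.mk₂ ℝ (fun x y e => inner ℝ (G.edgeVec e x) (G.edgeVec e y))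
    (fun x x' y => by ext e; simp [inner_add_left])
    (fun c x y => by ext e; simp only [map_smul, inner_smul_left, Pi.smul_apply]; simp)
    (fun x y y' => by ext e; simp [inner_add_right])
    (fun c x y => by ext e; simp only [map_smul, inner_smul_right, Pi.smul_apply]; simp)

theorem barForm_apply (G : ColoredGraph (ZMod k) N M) (T : Set M) (x y : N → ℂ) (e : T) :
    G.barForm T x y e = inner ℝ (G.edgeVec e x) (G.edgeVec e y) := rfl

theorem barForm_I_smul (G : ColoredGraph (ZMod k) N M) (T : Set M) (x : N → ℂ) :
    G.barForm T x (Complex.I • x) = 0 := by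
  ext e
  rw [barForm_apply, edgeVec_smul, Complex.inner_I_mul_self]
  rfl

theorem barForm_surjective_mono {G : ColoredGraph (ZMod k) N M} {T T' : Set M} (h : T ⊆ T')
    {x : N → ℂ} (hx : Function.Surjective (G.barForm T' x)) :
    Function.Surjective (G.barForm T x) := by
  classical
  intro z
  obtain ⟨y, hy⟩ := hx fun e => if he : (e : M) ∈ T then z ⟨e, he⟩ else 0
  refine ⟨y, funext fun e => ?_⟩
  exact (congrFun hy ⟨e, h e.2⟩).trans (dif_pos e.2)

/-- Maxwell counting: if the edge lengths are independent, then the kernel of the rigidity form of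
a subgraph has at most the expected dimension. The kernel contains the collapsed configurations
and also the infinitesimal rotation, which is not collapsed as there is an edge of nonzero
length. -/
theorem card_edges_add_finrank_collapsed_lt [Finite N] [Finite M]
    {G : ColoredGraph (ZMod k) N M} {x : N → ℂ} (hx : ∀ e, G.edgeVec e x ≠ 0)
    (H : G.Subgraph) (hsurj : Function.Surjective (G.barForm H.edges x))
    (hne : H.edges.Nonempty) :
    H.edges.ncard + 1 + finrank ℝ H.collapsed ≤ 2 * H.verts.ncard := by
  classical
  have := Fintype.ofFinite N
  have := Fintype.ofFinite H.edges
  let trunc : (N → ℂ) → (N → ℂ) := fun y v => if v ∈ H.verts then y v else 0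
  have htrunc : ∀ y, trunc y ∈ H.configurations := fun y v hv => if_neg hv
  have hedge : ∀ y, ∀ e ∈ H.edges, G.edgeVec e (trunc y) = G.edgeVec e y := by
    intro y e he
    simp only [edgeVec_apply, trunc, if_pos (H.tail_mem e he), if_pos (H.head_mem e he)]
  let f : H.configurations →ₗ[ℝ] (H.edges → ℝ) :=
    G.barForm H.edges x ∘ₗ H.configurations.subtype
  have hf : Function.Surjective f := by
    intro z
    obtain ⟨y, hy⟩ := hsurj z
    refine ⟨⟨trunc y, htrunc y⟩, ?_⟩
    rw [← hy]
    ext e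
    change inner ℝ _ (G.edgeVec e (trunc y)) = _
    rw [hedge y e e.2, barForm_apply]
  have hlt : H.collapsed < (LinearMap.ker f).map H.configurations.subtype := by
    refine SetLike.lt_iff_le_and_exists.2 ⟨fun y hy => ?_, trunc (Complex.I • x), ?_, ?_⟩
    · obtain ⟨h1, h2⟩ := Subgraph.mem_collapsed.1 hy
      refine ⟨⟨y, h1⟩, ?_, rfl⟩
      ext e
      change inner ℝ _ (G.edgeVec e y) = (0 : ℝ)
      rw [h2 e e.2, inner_zero_right]
    · refine ⟨⟨_, htrunc _⟩, ?_, rfl⟩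
      ext e
      change inner ℝ _ (G.edgeVec e (trunc _)) = (0 : ℝ)
      rw [hedge _ e e.2, edgeVec_smul, Complex.inner_I_mul_self]
    · intro hmem
      obtain ⟨e, he⟩ := hne
      have h := (Subgraph.mem_collapsed.1 hmem).2 e he
      rw [hedge _ e he, edgeVec_smul] at h
      exact mul_ne_zero Complex.I_ne_zero (hx e) h
  have h1 := Submodule.finrank_lt_finrank_of_lt hlt
  rw [Submodule.finrank_map_subtype_eq] at h1
  have h2 := LinearMap.finrank_range_add_finrank_ker f
  rw [LinearMap.range_eq_top.2 hf, finrank_top, finrank_fintype_fun_eq_card,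
    H.finrank_configurations, ← Nat.card_eq_fintype_card, Nat.card_coe_set_eq] at h2
  omega

theorem finrank_configurationSpace [Finite N] : finrank ℝ (N → ℂ) = 2 * Nat.card N := by
  have := Fintype.ofFinite N
  rw [finrank_pi_fintype]
  simp [Complex.finrank_real_complex, mul_comm]

/-- Under the sparsity count there is a configuration without collapsed edges whose edge lengths
are independent. The row of the edge `e` in the rigidity form at `I • z` spans the line in which
the hyperplane `z` meets the plane of all linear forms that factor through `G.edgeVec e`. -/
theorem exists_surjective_barForm [Finite N] [Finite M] {G : ColoredGraph (ZMod k) N M}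
    (h : ∀ F : Set M, F.Nonempty → F.ncard + 1 +
      finrank ℝ (⨅ e ∈ F, LinearMap.ker (G.edgeVec e) : Submodule ℝ (N → ℂ)) ≤ 2 * Nat.card N) :
    ∃ x, (∀ e, G.edgeVec e x ≠ 0) ∧ Function.Surjective (G.barForm Set.univ x) := by
  have := Fintype.ofFinite N
  have := Fintype.ofFinite M
  obtain ⟨z, hz, l, hlz, hl⟩ := exists_generic_hyperplane Complex.finrank_real_complex.le G.edgeVec
    (fun F hF => by
      have := h (F : Set M) hF
      rw [Set.ncard_coe_finset] at this
      rw [finrank_configurationSpace]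
      exact this)
  refine ⟨Complex.I • z, fun e => ?_, fun y => ?_⟩
  · rw [edgeVec_smul]
    exact mul_ne_zero Complex.I_ne_zero (hz e)
  · have hkey := fun e => Complex.dual_apply_mul_of_apply_eq_zero (l e) (hz e) (hlz e)
    have hc : ∀ e, l e (Complex.I * G.edgeVec e z) ≠ 0 := by
      intro e he
      refine hl.ne_zero e (LinearMap.ext fun v => ?_)
      have := hkey e (G.edgeVec e v)
      rw [he, zero_mul] at this
      exact (mul_eq_zero.1 this).resolve_right (by simpa using hz e)
    obtain ⟨v, hv⟩ := hl.surjective_pi_dual fun e =>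
      l e (Complex.I * G.edgeVec e z) * y ⟨e, trivial⟩ / ‖G.edgeVec e z‖ ^ 2
    refine ⟨v, funext fun ⟨e, _⟩ => ?_⟩
    have h1 : l e (G.edgeVec e v) = _ := congrFun hv e
    have h2 := hkey e (G.edgeVec e v)
    rw [h1, div_mul_cancel₀ _ (by simpa using hz e)] at h2
    rw [barForm_apply, edgeVec_smul]
    exact (mul_left_cancel₀ (hc e) h2).symm

/-- If the rotations are the only infinitesimal motions, then they are the only motions. -/
theorem eventually_eq_smul_of_ker_le [Finite N] [Finite M] {G : ColoredGraph (ZMod k) N M}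
    {T : Set M} {x : N → ℂ} (hx : x ≠ 0)
    (hker : ∀ y, G.barForm T x y = 0 → y ∈ ℝ ∙ (Complex.I • x)) :
    ∀ᶠ y in 𝓝 x, (∀ e ∈ T, ‖G.edgeVec e y‖ = ‖G.edgeVec e x‖) → ∃ c : ℂ, ‖c‖ = 1 ∧ y = c • x := by
  have := Fintype.ofFinite N
  have := Fintype.ofFinite T
  have h := eventually_sub_mem_span_of_ker_le (G.barForm T)
    (fun x y => by ext e; rw [barForm_apply, barForm_apply, real_inner_comm])
    (DistribSMul.toLinearMap ℝ (N → ℂ) Complex.I) (G.barForm_I_smul T) (x := x)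
    (smul_ne_zero Complex.I_ne_zero hx) hker
  filter_upwards [h] with y hy hlen
  obtain ⟨s, hs⟩ := Submodule.mem_span_singleton.1 (hy (by
    ext e
    rw [barForm_apply, barForm_apply, real_inner_self_eq_norm_sq, real_inner_self_eq_norm_sq,
      hlen e e.2]))
  have hne : (1 - s * Complex.I : ℂ) ≠ 0 := by
    intro h0
    simpa using congrArg Complex.re h0
  refine ⟨(1 + s * Complex.I) / (1 - s * Complex.I), ?_, funext fun v => ?_⟩
  · have hconj : (1 - s * Complex.I : ℂ) = conj (1 + s * Complex.I : ℂ) := by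
      simp [sub_eq_add_neg]
    rw [norm_div, hconj, Complex.norm_conj, div_self]
    rw [norm_ne_zero_iff]
    intro h0
    simpa using congrArg Complex.re h0
  · have hv := congrFun hs v
    simp only [DistribSMul.toLinearMap_apply, Pi.smul_apply, Pi.add_apply, Pi.sub_apply,
      Complex.real_smul, smul_eq_mul] at hv ⊢
    rw [div_mul_eq_mul_div, eq_div_iff hne]
    linear_combination -hv

/-- Where the rank is locally maximal, every infinitesimal motion is the velocity of a motion. -/
theorem exists_motion_of_rank_le [Finite N] [Finite M] {G : ColoredGraph (ZMod k) N M}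
    {T : Set M} {x : N → ℂ}
    (hrank : ∀ᶠ y in 𝓝 x, finrank ℝ (LinearMap.range (G.barForm T y)) ≤
      finrank ℝ (LinearMap.range (G.barForm T x)))
    {w : N → ℂ} (hw : G.barForm T x w = 0) :
    ∃ c : ℝ → N → ℂ, c 0 = x ∧ (∀ v, HasDerivAt (fun t => c t v) (w v) 0) ∧
      ∀ᶠ t in 𝓝 0, ∀ e ∈ T, ‖G.edgeVec e (c t)‖ = ‖G.edgeVec e x‖ := by
  have := Fintype.ofFinite N
  have := Fintype.ofFinite T
  let D : M → (N → ℂ) →L[ℝ] ℂ := fun e => (G.edgeVec e).toContinuousLinearMap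
  let f : (N → ℂ) → (T → ℝ) := fun y e => ‖D e y‖ ^ 2
  have hf : ContDiff ℝ 1 f := contDiff_pi.2 fun e => (D e).contDiff.norm_sq ℝ
  have hf' : ∀ y, (fderiv ℝ f y).toLinearMap = (2 : ℝ) • G.barForm T y := by
    intro y
    have h : HasFDerivAt f (ContinuousLinearMap.pi fun e : T =>
        2 • (innerSL ℝ (D e y)).comp (D e)) y :=
      hasFDerivAt_pi.2 fun e => (D e).hasFDerivAt.norm_sq
    rw [h.fderiv]
    refine LinearMap.ext fun v => funext fun e => ?_
    simp [barForm_apply, D]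
    ring
  have hrange : ∀ y, LinearMap.range (fderiv ℝ f y).toLinearMap =
      LinearMap.range (G.barForm T y) := fun y => by
    rw [hf', LinearMap.range_smul _ _ two_ne_zero]
  obtain ⟨c, hc0, hcd, hc⟩ := exists_curve_in_fiber_of_rank_le hf (x := x) (w := w)
    (hrank.mono fun y hy => by rw [hrange, hrange]; exact hy)
    (by
      have := LinearMap.congr_fun (hf' x) w
      rwa [LinearMap.smul_apply, hw, smul_zero] at this)
  refine ⟨c, hc0, hasDerivAt_pi.1 hcd, ?_⟩
  filter_upwards [hc] with t ht e he
  exact (sq_eq_sq₀ (norm_nonneg _) (norm_nonneg _)).1 (congrFun ht ⟨e, he⟩)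

end ColoredGraph

/-- The velocity of a motion through congruent configurations is an infinitesimal rotation.
The products `c t v * conj (c t u)` can only take two conjugate values, so they are constant. -/
theorem mem_span_I_smul_of_hasDerivAt {N : Type*} [Finite N] {x w : N → ℂ} {c : ℝ → N → ℂ}
    (hc0 : c 0 = x) (hc : ∀ v, HasDerivAt (fun t => c t v) (w v) 0)
    (h : ∀ᶠ t in 𝓝 0, ∃ a : ℂ, ‖a‖ = 1 ∧ ((∀ v, c t v = a * x v) ∨ ∀ v, c t v = a * conj (x v))) :
    w ∈ Submodule.span ℝ {Complex.I • x} := by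
  have hprod : ∀ u v, ∀ᶠ t in 𝓝 0, c t v * conj (c t u) = x v * conj (x u) := by
    intro u v
    have hcont : ContinuousAt (fun t => c t v * conj (c t u)) 0 :=
      (hc v).continuousAt.mul (Complex.continuous_conj.continuousAt.comp (hc u).continuousAt)
    have htwo : ∀ᶠ t in 𝓝 0, c t v * conj (c t u) = x v * conj (x u) ∨
        c t v * conj (c t u) = conj (x v * conj (x u)) := by
      filter_upwards [h] with t ⟨a, ha, hat⟩
      have haa : a * conj a = 1 := by
        rw [Complex.mul_conj, Complex.normSq_eq_norm_sq, ha]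
        norm_num
      rcases hat with hat | hat
      · left
        rw [hat, hat, map_mul]
        linear_combination x v * conj (x u) * haa
      · right
        rw [hat, hat]
        simp only [map_mul, Complex.conj_conj]
        linear_combination conj (x v) * x u * haa
    by_cases hz : x v * conj (x u) = conj (x v * conj (x u))
    · filter_upwards [htwo] with t ht
      rcases ht with ht | ht
      · exact ht
      · exact ht.trans hz.symm
    · have hne := hcont.eventually_ne (y := conj (x v * conj (x u))) (by rwa [hc0])
      filter_upwards [htwo, hne] with t ht htn
      exact ht.resolve_right htn
  by_cases hx : x = 0
  · have hw : w = 0 := by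
      funext v
      refine (hc v).unique ((hasDerivAt_const (0 : ℝ) (0 : ℂ)).congr_of_eventuallyEq ?_)
      filter_upwards [h] with t ⟨a, _, hat⟩
      rcases hat with hat | hat <;> simp [hat, hx]
    rw [hw]
    exact Submodule.zero_mem _
  · obtain ⟨u, hu⟩ := Function.ne_iff.1 hx
    have hu0 : x u ≠ 0 := hu
    have hconj : HasDerivAt (fun t => conj (c t u)) (conj (w u)) 0 := (hc u).star
    have h1 : w u * conj (x u) + x u * conj (w u) = 0 := by
      have h2 := (hc u).mul hconj
      rw [hc0] at h2
      exact h2.unique ((hasDerivAt_const (0 : ℝ) (x u * conj (x u))).congr_of_eventuallyEq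
        (hprod u u))
    have h2 : ∀ v, w v * (x u * conj (x u)) = x v * conj (x u) * w u := by
      intro v
      refine ((hc v).mul_const (x u * conj (x u))).unique
        (((hc u).const_mul (x v * conj (x u))).congr_of_eventuallyEq ?_)
      filter_upwards [hprod u v, hprod u u] with t hv hu'
      rw [← hu', ← hv]
      ring
    have hu1 : conj (x u) ≠ 0 := by simpa using hu0
    have hre : (w u / x u).re = 0 := by
      have h3 : w u / x u + conj (w u / x u) = 0 := by
        rw [map_div₀, div_add_div _ _ hu0 hu1, h1, zero_div]
      rw [Complex.add_conj] at h3
      have h4 : 2 * (w u / x u).re = 0 := by exact_mod_cast h3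
      linarith
    refine Submodule.mem_span_singleton.2 ⟨(w u / x u).im, funext fun v => ?_⟩
    have h3 : ((w u / x u).im : ℂ) * Complex.I = w u / x u := by
      conv_rhs => rw [← Complex.re_add_im (w u / x u), hre]
      simp
    rw [Pi.smul_apply, Pi.smul_apply, Complex.real_smul, smul_eq_mul, ← mul_assoc, h3,
      div_mul_eq_mul_div, div_eq_iff hu0]
    refine mul_right_cancel₀ hu1 ?_
    linear_combination -(h2 v)

/-! ### Symmetric frameworks and their colored quotients -/

namespace ConeGraph

variable {k : ℕ} [NeZero k] {V E : Type*} [AddAction (ZMod k) V] [AddAction (ZMod k) E]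

/-- Restriction to representatives of the vertex orbits identifies the equivariant configurations
with all configurations of the quotient. Surjectivity uses that the action is free. -/
noncomputable def equivariantEquiv (X : ConeGraph k V E) (rep : ConeOrbits k V → V)
    (hrep : ∀ o, Quotient.mk (AddAction.orbitRel (ZMod k) V) (rep o) = o) :
    equivariantMaps k V ≃ₗ[ℝ] (ConeOrbits k V → ℂ) :=
  LinearEquiv.ofBijective
    (LinearMap.funLeft ℝ ℂ rep ∘ₗ (equivariantMaps k V).subtype) <| by
    have hg : ∀ v : V, ∃ g : ZMod k,
        g +ᵥ rep (Quotient.mk (AddAction.orbitRel (ZMod k) V) v) = v := fun v =>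
      Quotient.exact (hrep (Quotient.mk (AddAction.orbitRel (ZMod k) V) v)).symm
    choose g hg using hg
    constructor
    · intro p q hpq
      refine Subtype.ext (funext fun v => ?_)
      rw [← hg v, p.2, q.2]
      exact congrArg _ (congrFun hpq _)
    · intro y
      let q : V → ℂ := fun v => ZMod.stdAddChar (g v) *
        y (Quotient.mk (AddAction.orbitRel (ZMod k) V) v)
      have hmk : ∀ (a : ZMod k) (v : V), Quotient.mk (AddAction.orbitRel (ZMod k) V) (a +ᵥ v) =
          Quotient.mk (AddAction.orbitRel (ZMod k) V) v := fun a v => Quotient.sound ⟨a, rfl⟩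
      have huniq : ∀ (a b : ZMod k) (v : V), a +ᵥ v = b +ᵥ v → a = b := by
        intro a b v hab
        refine sub_eq_zero.1 (X.free (a - b) v ?_)
        rw [sub_eq_neg_add, add_vadd, hab, neg_vadd_vadd]
      refine ⟨⟨q, fun a v => ?_⟩, funext fun o => ?_⟩
      · have h1 : g (a +ᵥ v) = a + g v := by
          refine huniq _ _ (rep (Quotient.mk (AddAction.orbitRel (ZMod k) V) v)) ?_
          have := hg (a +ᵥ v)
          rw [hmk] at this
          rw [this, add_vadd, hg]
        simp only [q]
        rw [hmk, h1, AddChar.map_add_eq_mul, mul_assoc]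
      · have h1 : g (rep o) = 0 := by
          refine huniq _ _ (rep o) ?_
          have := hg (rep o)
          rw [hrep] at this
          rw [this, zero_vadd]
        change ZMod.stdAddChar (g (rep o)) * y _ = y o
        rw [h1, hrep, AddChar.map_zero_eq_one, one_mul]

/-- Every edge in an edge orbit is, up to a rotation and its orientation, the edge recorded by the
colored quotient. -/
theorem exists_edge_eq_mul_edgeVec {X : ConeGraph k V E}
    {G : ColoredGraph (ZMod k) (ConeOrbits k V) (ConeOrbits k E)} {rep : ConeOrbits k V → V}
    (hG : ∀ o : ConeOrbits k E, ∃ e : E, Quotient.mk (AddAction.orbitRel (ZMod k) E) e = o ∧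
      X.ends e = s(rep (G.tail o), G.color o +ᵥ rep (G.head o)))
    {e : E} {i j : V} (he : X.ends e = s(i, j)) :
    ∃ c : ℂ, ‖c‖ = 1 ∧ ∀ q ∈ equivariantMaps k V,
      q j - q i = c * G.edgeVec (Quotient.mk (AddAction.orbitRel (ZMod k) E) e) (q ∘ rep) := by
  set o := Quotient.mk (AddAction.orbitRel (ZMod k) E) e with ho
  obtain ⟨e₀, he₀, hends⟩ := hG o
  obtain ⟨g, hg⟩ : ∃ g : ZMod k, g +ᵥ e₀ = e := Quotient.exact (ho.symm.trans he₀.symm)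
  have h : s(g +ᵥ rep (G.tail o), g +ᵥ (G.color o +ᵥ rep (G.head o))) = s(i, j) := by
    rw [← he, ← hg, X.ends_vadd, hends, Sym2.map_mk]
  have hval : ∀ q ∈ equivariantMaps k V,
      q (g +ᵥ (G.color o +ᵥ rep (G.head o))) - q (g +ᵥ rep (G.tail o)) =
        ZMod.stdAddChar g * G.edgeVec o (q ∘ rep) := by
    intro q hq
    rw [hq, hq, hq, ColoredGraph.edgeVec_apply, mul_sub]
    rfl
  rcases Sym2.eq_iff.1 h with ⟨rfl, rfl⟩ | ⟨rfl, rfl⟩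
  · exact ⟨ZMod.stdAddChar g, AddChar.norm_apply _ _, hval⟩
  · refine ⟨-ZMod.stdAddChar g, by rw [norm_neg, AddChar.norm_apply], fun q hq => ?_⟩
    rw [neg_mul, ← hval q hq, neg_sub]

theorem mem_realizationSpace_iff {X : ConeGraph k V E}
    {G : ColoredGraph (ZMod k) (ConeOrbits k V) (ConeOrbits k E)} {rep : ConeOrbits k V → V}
    (hG : ∀ o : ConeOrbits k E, ∃ e : E, Quotient.mk (AddAction.orbitRel (ZMod k) E) e = o ∧
      X.ends e = s(rep (G.tail o), G.color o +ᵥ rep (G.head o)))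
    {len : E → ℝ} {S : Set E} {q : V → ℂ} :
    q ∈ X.realizationSpace len S ↔ q ∈ equivariantMaps k V ∧ ∀ e ∈ S,
      ‖G.edgeVec (Quotient.mk (AddAction.orbitRel (ZMod k) E) e) (q ∘ rep)‖ = len e := by
  refine and_congr_right fun hq => forall₂_congr fun e _ => ?_
  constructor
  · intro h
    induction hij : X.ends e using Sym2.ind with
    | _ i j =>
      obtain ⟨c, hc, hcq⟩ := exists_edge_eq_mul_edgeVec hG hij
      rw [← h i j hij, hcq q hq, norm_mul, hc, one_mul]
  · intro h i j hij
    obtain ⟨c, hc, hcq⟩ := exists_edge_eq_mul_edgeVec hG hij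
    rw [hcq q hq, norm_mul, hc, one_mul, h]

theorem rigidityMap_apply {X : ConeGraph k V E}
    {G : ColoredGraph (ZMod k) (ConeOrbits k V) (ConeOrbits k E)} {rep : ConeOrbits k V → V}
    (hG : ∀ o : ConeOrbits k E, ∃ e : E, Quotient.mk (AddAction.orbitRel (ZMod k) E) e = o ∧
      X.ends e = s(rep (G.tail o), G.color o +ᵥ rep (G.head o)))
    {p : V → ℂ} (hp : p ∈ equivariantMaps k V) (q : equivariantMaps k V) (e : E) :
    X.rigidityMap p q e = G.barForm Set.univ (p ∘ rep) (q.1 ∘ rep)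
      ⟨Quotient.mk (AddAction.orbitRel (ZMod k) E) e, trivial⟩ := by
  change Sym2.lift _ (X.ends e) = _
  induction hij : X.ends e using Sym2.ind with
  | _ i j =>
    obtain ⟨c, hc, hcq⟩ := exists_edge_eq_mul_edgeVec hG hij
    rw [Sym2.lift_mk, ColoredGraph.barForm_apply]
    change inner ℝ (p j - p i) (q.1 j - q.1 i) = _
    rw [hcq p hp, hcq q.1 q.2]
    have h := Complex.mul_conj c
    rw [Complex.normSq_eq_norm_sq, hc] at h
    simp only [Complex.inner, map_mul]
    congr 1
    push_cast at h
    linear_combination (conj (G.edgeVec (Quotient.mk (AddAction.orbitRel (ZMod k) E) e) (p ∘ rep)) *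
      G.edgeVec (Quotient.mk (AddAction.orbitRel (ZMod k) E) e) (q.1 ∘ rep)) * h

/-- The rigidity system of the framework repeats each row of the colored quotient along an orbit. -/
theorem rigidityRank_eq {X : ConeGraph k V E}
    {G : ColoredGraph (ZMod k) (ConeOrbits k V) (ConeOrbits k E)} {rep : ConeOrbits k V → V}
    (hrep : ∀ o, Quotient.mk (AddAction.orbitRel (ZMod k) V) (rep o) = o)
    (hG : ∀ o : ConeOrbits k E, ∃ e : E, Quotient.mk (AddAction.orbitRel (ZMod k) E) e = o ∧
      X.ends e = s(rep (G.tail o), G.color o +ᵥ rep (G.head o)))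
    {p : V → ℂ} (hp : p ∈ equivariantMaps k V) :
    X.rigidityRank p = finrank ℝ (LinearMap.range (G.barForm Set.univ (p ∘ rep))) := by
  let f : E → (Set.univ : Set (ConeOrbits k E)) := fun e =>
    ⟨Quotient.mk (AddAction.orbitRel (ZMod k) E) e, trivial⟩
  have hf : Function.Surjective f := by
    rintro ⟨o, ho⟩
    obtain ⟨e, rfl⟩ := Quotient.exists_rep o
    exact ⟨e, rfl⟩
  have hcomp : X.rigidityMap p = LinearMap.funLeft ℝ ℝ f ∘ₗ
      (G.barForm Set.univ (p ∘ rep) ∘ₗ (X.equivariantEquiv rep hrep).toLinearMap) := by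
    refine LinearMap.ext fun q => funext fun e => ?_
    rw [rigidityMap_apply hG hp]
    rfl
  rw [rigidityRank, hcomp, LinearMap.range_comp, LinearEquiv.range_comp]
  exact (Submodule.equivMapOfInjective _ (LinearMap.funLeft_injective_of_surjective ℝ ℝ f hf)
    _).finrank_eq.symm

/-- Two equivariant configurations that differ by an isometry of the plane differ by a linear
one, since the isometry preserves the common centroid, the origin, of the orbits. It commutes with
the rotations: it can only be a reflection if the rotations have order two. -/
theorem exists_linearIsometryEquiv_of_congruent (hk : 2 ≤ k) [Nonempty V] {p q : V → ℂ}
    (hp : p ∈ equivariantMaps k V) (hq : q ∈ equivariantMaps k V) {ψ : ℂ ≃ᵢ ℂ}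
    (h : ∀ v, q v = ψ (p v)) :
    ∃ L : ℂ ≃ₗᵢ[ℝ] ℂ, (∀ v, q v = L (p v)) ∧
      (p ≠ 0 → ∀ (g : ZMod k) (z : ℂ), L (ZMod.stdAddChar g * z) = ZMod.stdAddChar g * L z) := by
  have hsum : ∑ g : ZMod k, (ZMod.stdAddChar g : ℂ) = 0 := by
    refine AddChar.sum_eq_zero_of_ne_one fun h1 => ?_
    have := Fact.mk (show 1 < k from hk)
    have h2 : (ZMod.stdAddChar (1 : ZMod k) : ℂ) = ZMod.stdAddChar (0 : ZMod k) := by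
      rw [h1]
      rfl
    exact one_ne_zero (ZMod.injective_stdAddChar h2)
  let L := ψ.toRealLinearIsometryEquiv
  have hL : ∀ z, ψ z = L z + ψ 0 := fun z => by
    rw [IsometryEquiv.toRealLinearIsometryEquiv_apply, sub_add_cancel]
  have h0 : ψ 0 = 0 := by
    obtain ⟨v⟩ := ‹Nonempty V›
    have hcentroid : ∀ r ∈ equivariantMaps k V, ∑ g : ZMod k, r (g +ᵥ v) = 0 := by
      intro r hr
      rw [Finset.sum_congr rfl fun g _ => hr g v, ← Finset.sum_mul, hsum, zero_mul]
    have h1 := hcentroid q hq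
    rw [Finset.sum_congr rfl fun g _ => (h (g +ᵥ v)).trans (hL _), Finset.sum_add_distrib,
      ← map_sum, hcentroid p hp, map_zero, zero_add, Finset.sum_const, Finset.card_univ, ZMod.card,
      nsmul_eq_mul, mul_eq_zero] at h1
    exact h1.resolve_left (by exact_mod_cast NeZero.ne k)
  have hqL : ∀ v, q v = L (p v) := fun v => by rw [h, hL, h0, add_zero]
  refine ⟨L, hqL, fun hp0 g z => ?_⟩
  obtain ⟨a, ha | ha⟩ := linear_isometry_complex L
  · rw [ha, rotation_apply, rotation_apply]
    ring
  · have hLz : ∀ z, L z = a * conj z := fun z => by rw [ha]; rfl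
    obtain ⟨v, hv⟩ := Function.ne_iff.1 hp0
    have h1 := hq g v
    rw [hqL, hqL, hp, hLz, hLz, map_mul] at h1
    have h2 : conj (ZMod.stdAddChar g : ℂ) = ZMod.stdAddChar g := by
      have hne : (a : ℂ) * conj (p v) ≠ 0 := mul_ne_zero (Circle.coe_ne_zero a) (by simpa using hv)
      refine mul_right_cancel₀ hne ?_
      linear_combination h1
    rw [hLz, hLz, map_mul, h2]
    ring

theorem isRigid_iff_isOpen {X : ConeGraph k V E} {len : E → ℝ} {S : Set E}
    {p : X.realizationSpace len S} :
    X.IsRigid len S p ↔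
      IsOpen {q : X.realizationSpace len S | ∃ ψ : ℂ ≃ᵢ ℂ, ∀ v, q.1 v = ψ (p.1 v)} := by
  rw [IsRigid, ← isQuotientMap_quotient_mk'.isOpen_preimage]
  refine iff_of_eq (congrArg IsOpen (Set.ext fun q => ?_))
  change Quotient.mk (X.congruent len S) q = Quotient.mk (X.congruent len S) p ↔ _
  rw [eq_comm]
  exact Quotient.eq (r := X.congruent len S)

theorem IsRigid.eventually {X : ConeGraph k V E} {len : E → ℝ} {S : Set E}
    {p : X.realizationSpace len S} (h : X.IsRigid len S p) :
    ∀ᶠ q in 𝓝 p.1, q ∈ X.realizationSpace len S → ∃ ψ : ℂ ≃ᵢ ℂ, ∀ v, q v = ψ (p.1 v) := by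
  have h1 := (isRigid_iff_isOpen.1 h).mem_nhds ⟨IsometryEquiv.refl ℂ, fun _ => rfl⟩
  rw [nhds_subtype_eq_comap, mem_comap] at h1
  obtain ⟨U, hU, hUs⟩ := h1
  filter_upwards [hU] with q hq hqS
  exact hUs (a := ⟨q, hqS⟩) hq

/-- A realization is rigid if all nearby realizations are congruent to it. The openness at another
realization of the same class follows, as the congruence acts on the realization space. -/
theorem isRigid_of_eventually (hk : 2 ≤ k) [Nonempty V] {X : ConeGraph k V E} {len : E → ℝ}
    {S : Set E} {p : X.realizationSpace len S} (hp0 : p.1 ≠ 0)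
    (h : ∀ᶠ q in 𝓝 p.1, q ∈ X.realizationSpace len S → ∃ ψ : ℂ ≃ᵢ ℂ, ∀ v, q v = ψ (p.1 v)) :
    X.IsRigid len S p := by
  rw [isRigid_iff_isOpen, isOpen_iff_mem_nhds]
  rintro q ⟨ψ, hψ⟩
  obtain ⟨L, hL, hcomm⟩ := exists_linearIsometryEquiv_of_congruent hk p.2.1 q.2.1 hψ
  replace hcomm : ∀ (g : ZMod k) (z : ℂ),
      L.symm (ZMod.stdAddChar g * z) = ZMod.stdAddChar g * L.symm z := fun g z => by
    rw [LinearIsometryEquiv.symm_apply_eq, hcomm hp0, L.apply_symm_apply]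
  have hcont : Continuous fun (r : V → ℂ) v => L.symm (r v) := by fun_prop
  have hLq : (fun v => L.symm (q.1 v)) = p.1 := funext fun v => by
    rw [hL, L.symm_apply_apply]
  have h1 : ∀ᶠ r : V → ℂ in 𝓝 q.1, (fun v => L.symm (r v)) ∈ X.realizationSpace len S →
      ∃ ψ : ℂ ≃ᵢ ℂ, ∀ v, L.symm (r v) = ψ (p.1 v) :=
    (hcont.tendsto' _ _ hLq).eventually h
  rw [nhds_subtype_eq_comap]
  refine mem_comap.2 ⟨_, h1, fun r hr => ?_⟩
  obtain ⟨χ, hχ⟩ := hr ⟨fun g v => by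
    beta_reduce
    rw [r.2.1, hcomm], fun e he i j hij => by
    rw [← map_sub, L.symm.norm_map, r.2.2 e he i j hij]⟩
  refine ⟨χ.trans L.toIsometryEquiv, fun v => ?_⟩
  change r.1 v = L (χ (p.1 v))
  rw [← hχ, L.apply_symm_apply]

end ConeGraph

/-! ### Rigidity in terms of the colored quotient -/

namespace ConeGraph

variable {k : ℕ} [NeZero k] {V E : Type*} [AddAction (ZMod k) V] [AddAction (ZMod k) E]

/-- Infinitesimal rigidity implies rigidity. Here and below, `S` is the union of the edge orbits
in `T`. -/
theorem isRigid_of_ker_le (hk : 2 ≤ k) [Finite V] [Nonempty V] [Finite E] {X : ConeGraph k V E}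
    {G : ColoredGraph (ZMod k) (ConeOrbits k V) (ConeOrbits k E)} {rep : ConeOrbits k V → V}
    (hrep : ∀ o, Quotient.mk (AddAction.orbitRel (ZMod k) V) (rep o) = o)
    (hG : ∀ o : ConeOrbits k E, ∃ e : E, Quotient.mk (AddAction.orbitRel (ZMod k) E) e = o ∧
      X.ends e = s(rep (G.tail o), G.color o +ᵥ rep (G.head o)))
    {len : E → ℝ} {S : Set E} {T : Set (ConeOrbits k E)}
    (hST : ∀ e, e ∈ S ↔ Quotient.mk (AddAction.orbitRel (ZMod k) E) e ∈ T)
    (p : X.realizationSpace len S) (hp0 : p.1 ∘ rep ≠ 0)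
    (hker : ∀ y, G.barForm T (p.1 ∘ rep) y = 0 → y ∈ ℝ ∙ (Complex.I • (p.1 ∘ rep))) :
    X.IsRigid len S p := by
  have : Finite (ConeOrbits k V) := Quotient.finite _
  have : Finite (ConeOrbits k E) := Quotient.finite _
  have hp1 : p.1 ≠ 0 := fun h => hp0 (by rw [h]; rfl)
  refine isRigid_of_eventually hk hp1 ?_
  have hcont : Continuous fun q : V → ℂ => q ∘ rep :=
    continuous_pi fun o => continuous_apply (rep o)
  filter_upwards [hcont.continuousAt.eventually
    (ColoredGraph.eventually_eq_smul_of_ker_le hp0 hker)] with q hq hqS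
  have hpe := ((mem_realizationSpace_iff hG).1 p.2)
  have hqe := ((mem_realizationSpace_iff hG).1 hqS)
  obtain ⟨c, hc, hcq⟩ := hq fun o ho => by
    obtain ⟨e, rfl⟩ := Quotient.exists_rep o
    rw [hqe.2 e ((hST e).2 ho), hpe.2 e ((hST e).2 ho)]
  have heq : (⟨q, hqe.1⟩ : equivariantMaps k V) = ⟨c • p.1, fun g v => by
      simp only [Pi.smul_apply, smul_eq_mul, hpe.1 g v]; ring⟩ :=
    (X.equivariantEquiv rep hrep).injective hcq
  refine ⟨(rotation ⟨c, mem_sphere_zero_iff_norm.2 hc⟩).toIsometryEquiv, fun v => ?_⟩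
  exact congrFun (congrArg Subtype.val heq) v

/-- At a rigid realization of locally maximal rank the rotation spans the infinitesimal motions. -/
theorem ker_le_of_isRigid (hk : 2 ≤ k) [Finite V] [Nonempty V] [Finite E] {X : ConeGraph k V E}
    {G : ColoredGraph (ZMod k) (ConeOrbits k V) (ConeOrbits k E)} {rep : ConeOrbits k V → V}
    (hrep : ∀ o, Quotient.mk (AddAction.orbitRel (ZMod k) V) (rep o) = o)
    (hG : ∀ o : ConeOrbits k E, ∃ e : E, Quotient.mk (AddAction.orbitRel (ZMod k) E) e = o ∧
      X.ends e = s(rep (G.tail o), G.color o +ᵥ rep (G.head o)))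
    {len : E → ℝ} {S : Set E} {T : Set (ConeOrbits k E)}
    (hST : ∀ e, e ∈ S ↔ Quotient.mk (AddAction.orbitRel (ZMod k) E) e ∈ T)
    (p : X.realizationSpace len S)
    (hrank : ∀ᶠ y in 𝓝 (p.1 ∘ rep), finrank ℝ (LinearMap.range (G.barForm T y)) ≤
      finrank ℝ (LinearMap.range (G.barForm T (p.1 ∘ rep))))
    (hrigid : X.IsRigid len S p) (w : ConeOrbits k V → ℂ) (hw : G.barForm T (p.1 ∘ rep) w = 0) :
    w ∈ ℝ ∙ (Complex.I • (p.1 ∘ rep)) := by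
  have : Finite (ConeOrbits k V) := Quotient.finite _
  have : Finite (ConeOrbits k E) := Quotient.finite _
  have := Fintype.ofFinite V
  have := Fintype.ofFinite (ConeOrbits k V)
  obtain ⟨c, hc0, hcd, hc⟩ := ColoredGraph.exists_motion_of_rank_le hrank hw
  let Φ := X.equivariantEquiv rep hrep
  let lift : (ConeOrbits k V → ℂ) →ₗ[ℝ] V → ℂ :=
    (equivariantMaps k V).subtype ∘ₗ Φ.symm.toLinearMap
  have hlift : ∀ y, lift y ∘ rep = y := fun y => Φ.apply_symm_apply y
  have hlifte : ∀ y, lift y ∈ equivariantMaps k V := fun y => (Φ.symm y).2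
  have hpe := (mem_realizationSpace_iff hG).1 p.2
  have hliftp : lift (c 0) = p.1 := by
    rw [hc0]
    exact congrArg Subtype.val (Φ.symm_apply_apply ⟨p.1, hpe.1⟩)
  have hccont : ContinuousAt c 0 := continuousAt_pi.2 fun v => (hcd v).continuousAt
  have htend : Tendsto (fun t => lift (c t)) (𝓝 0) (𝓝 p.1) := by
    rw [← hliftp]
    exact lift.continuous_of_finiteDimensional.continuousAt.tendsto.comp hccont
  refine mem_span_I_smul_of_hasDerivAt hc0 hcd ?_
  filter_upwards [hc, htend.eventually hrigid.eventually] with t ht hcong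
  obtain ⟨ψ, hψ⟩ := hcong ((mem_realizationSpace_iff hG).2 ⟨hlifte _, fun e he => by
    rw [hlift, ht _ ((hST e).1 he), hpe.2 e he]⟩)
  obtain ⟨L, hL, -⟩ := exists_linearIsometryEquiv_of_congruent hk hpe.1 (hlifte _) hψ
  have hcL : ∀ o, c t o = L (p.1 (rep o)) := fun o => by
    rw [← hL]
    exact (congrFun (hlift (c t)) o).symm
  obtain ⟨a, ha | ha⟩ := linear_isometry_complex L
  · exact ⟨a, Circle.norm_coe a, Or.inl fun o => by rw [hcL, ha, rotation_apply]; rfl⟩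
  · exact ⟨a, Circle.norm_coe a, Or.inr fun o => by rw [hcL, ha]; rfl⟩

end ConeGraph

namespace ColoredGraph

variable {k : ℕ} [NeZero k] {N M : Type*}

/-- If every edge can be removed without the remaining ones determining its length to first order,
then the edge lengths are independent. -/
theorem barForm_univ_surjective_of_exists [Finite M] {G : ColoredGraph (ZMod k) N M} {x : N → ℂ}
    (h : ∀ o, ∃ y, G.barForm {o}ᶜ x y = 0 ∧ G.barForm Set.univ x y ≠ 0) :
    Function.Surjective (G.barForm Set.univ x) := by
  classical
  have := Fintype.ofFinite (Set.univ : Set M)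
  rw [← LinearMap.range_eq_top, eq_top_iff, ← (Pi.basisFun ℝ (Set.univ : Set M)).span_eq,
    Submodule.span_le]
  rintro _ ⟨o, rfl⟩
  obtain ⟨y, hy0, hy⟩ := h o
  have h1 : ∀ o', o' ≠ o → G.barForm Set.univ x y o' = 0 := fun o' ho' =>
    congrFun hy0 ⟨o'.1, fun heq => ho' (Subtype.ext heq)⟩
  have h2 : G.barForm Set.univ x y o ≠ 0 := by
    intro h0
    refine hy (funext fun o' => ?_)
    by_cases ho' : o' = o
    · rw [ho', h0]; rfl
    · exact h1 o' ho'
  refine ⟨(G.barForm Set.univ x y o)⁻¹ • y, funext fun o' => ?_⟩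
  rw [map_smul, Pi.smul_apply, smul_eq_mul, Pi.basisFun_apply]
  by_cases ho' : o' = o
  · rw [ho', inv_mul_cancel₀ h2, Pi.single_eq_same]
  · rw [h1 o' ho', mul_zero, Pi.single_eq_of_ne ho']

/-- When the edge lengths are independent, the kernel has the expected dimension. -/
theorem finrank_ker_barForm_add [Finite N] [Finite M] {G : ColoredGraph (ZMod k) N M} {T : Set M}
    {x : N → ℂ} (h : Function.Surjective (G.barForm T x)) :
    T.ncard + finrank ℝ (LinearMap.ker (G.barForm T x)) = 2 * Nat.card N := by
  have := Fintype.ofFinite N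
  have := Fintype.ofFinite T
  have h1 := LinearMap.finrank_range_add_finrank_ker (G.barForm T x)
  rwa [LinearMap.range_eq_top.2 h, finrank_top, finrank_fintype_fun_eq_card,
    finrank_configurationSpace, ← Nat.card_eq_fintype_card, Nat.card_coe_set_eq] at h1

/-- Sparsity of the subgraphs that contain all vertices is all that the construction of
independent edge lengths needs. -/
theorem IsConeLaman.exists_surjective_barForm [Finite N] [Finite M]
    {G : ColoredGraph (ZMod k) N M} (h : G.IsConeLaman) :
    ∃ x, (∀ e, G.edgeVec e x ≠ 0) ∧ Function.Surjective (G.barForm Set.univ x) := by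
  refine ColoredGraph.exists_surjective_barForm fun F hF => ?_
  let H : G.Subgraph := ⟨Set.univ, F, fun _ _ => trivial, fun _ _ => trivial⟩
  have h1 := h.2 H hF
  rw [← H.finrank_collapsed] at h1
  have h2 : H.collapsed = ⨅ e ∈ F, LinearMap.ker (G.edgeVec e) := by
    refine inf_eq_right.2 fun x _ v hv => ?_
    exact absurd trivial hv
  have h3 : H.verts.ncard = Nat.card N := Set.ncard_univ N
  rw [h2, h3] at h1
  have h4 : H.edges = F := rfl
  rw [h4] at h1
  omega

theorem isConeLaman_of_surjective_barForm [Finite N] [Finite M] {G : ColoredGraph (ZMod k) N M}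
    {x : N → ℂ} (hx : ∀ e, G.edgeVec e x ≠ 0) (hsurj : Function.Surjective (G.barForm Set.univ x))
    (hcard : Nat.card M + 1 = 2 * Nat.card N) : G.IsConeLaman := by
  refine ⟨by omega, fun H hne => ?_⟩
  have h := card_edges_add_finrank_collapsed_lt hx H
    (barForm_surjective_mono (Set.subset_univ _) hsurj) hne
  rw [← H.finrank_collapsed]
  omega

end ColoredGraph

theorem theorem2 {k : ℕ} [NeZero k] (hk : 2 ≤ k) {V E : Type*} [Finite V] [Nonempty V] [Finite E]
    [AddAction (ZMod k) V] [AddAction (ZMod k) E] (X : ConeGraph k V E)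
    (len : E → ℝ) (hlen : ∀ e, 0 < len e)
    (p : X.realizationSpace len Set.univ) (hp : X.IsGeneric p.1)
    (G : ColoredGraph (ZMod k) (ConeOrbits k V) (ConeOrbits k E)) (hG : X.IsColoredQuotient G) :
    X.IsMinimallyRigid len p ↔ G.IsConeLaman := by
  obtain ⟨rep, hrep, hE⟩ := hG
  have : Finite (ConeOrbits k V) := Quotient.finite _
  have : Finite (ConeOrbits k E) := Quotient.finite _
  have := Fintype.ofFinite (ConeOrbits k V)
  have : Nonempty (ConeOrbits k V) :=
    ⟨Quotient.mk (AddAction.orbitRel (ZMod k) V) (Classical.arbitrary V)⟩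
  have hN : 0 < Nat.card (ConeOrbits k V) := Nat.card_pos
  set x := p.1 ∘ rep with hxdef
  have hpe := (ConeGraph.mem_realizationSpace_iff hE).1 p.2
  have hx : ∀ o, G.edgeVec o x ≠ 0 := fun o => by
    obtain ⟨e, rfl⟩ := Quotient.exists_rep o
    rw [← norm_pos_iff]
    exact (hlen e).trans_eq (hpe.2 e trivial).symm
  have hrank : ∀ y, (∀ o, G.edgeVec o y ≠ 0) →
      finrank ℝ (LinearMap.range (G.barForm Set.univ y)) ≤
        finrank ℝ (LinearMap.range (G.barForm Set.univ x)) := by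
    intro y hy
    let q := (X.equivariantEquiv rep hrep).symm y
    have hqy : q.1 ∘ rep = y := (X.equivariantEquiv rep hrep).apply_symm_apply y
    have h := hp (fun e => ‖G.edgeVec (Quotient.mk _ e) y‖) (fun e => norm_pos_iff.2 (hy _)) q.1
      ((ConeGraph.mem_realizationSpace_iff hE).2 ⟨q.2, fun e _ => by rw [hqy]⟩)
    rwa [ConeGraph.rigidityRank_eq hrep hE q.2, ConeGraph.rigidityRank_eq hrep hE hpe.1, hqy] at h
  have hrank' : ∀ᶠ y in 𝓝 x, finrank ℝ (LinearMap.range (G.barForm Set.univ y)) ≤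
      finrank ℝ (LinearMap.range (G.barForm Set.univ x)) := by
    have h : ∀ᶠ y in 𝓝 x, ∀ o, G.edgeVec o y ≠ 0 := eventually_all.2 fun o =>
      (G.edgeVec o).continuous_of_finiteDimensional.continuousAt.eventually_ne (hx o)
    exact h.mono hrank
  have huniv : ∀ e : E, e ∈ Set.univ ↔
      Quotient.mk (AddAction.orbitRel (ZMod k) E) e ∈ Set.univ := fun e => by simp
  have hcompl : ∀ e e' : E, e' ∈ (AddAction.orbit (ZMod k) e)ᶜ ↔
      Quotient.mk (AddAction.orbitRel (ZMod k) E) e' ∈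
        ({Quotient.mk (AddAction.orbitRel (ZMod k) E) e}ᶜ : Set (ConeOrbits k E)) := fun e e' =>
    not_congr (Quotient.eq (r := AddAction.orbitRel (ZMod k) E)).symm
  have hspan : finrank ℝ (ℝ ∙ (Complex.I • x)) ≤ 1 := finrank_span_le_card _ |>.trans (by simp)
  constructor
  · rintro ⟨hrigid, hmin⟩
    have hker := ConeGraph.ker_le_of_isRigid hk hrep hE huniv p hrank' hrigid
    have hx0 : x ≠ 0 := by
      intro h0
      have htop : LinearMap.ker (G.barForm Set.univ x) = ⊤ := by
        rw [h0, map_zero, LinearMap.ker_zero]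
      have h1 := (Submodule.finrank_mono
        (show LinearMap.ker (G.barForm Set.univ x) ≤ ℝ ∙ (Complex.I • x) from hker)).trans hspan
      rw [htop, finrank_top, ColoredGraph.finrank_configurationSpace] at h1
      omega
    have hsurj : Function.Surjective (G.barForm Set.univ x) := by
      refine ColoredGraph.barForm_univ_surjective_of_exists fun o => ?_
      obtain ⟨e, rfl⟩ := Quotient.exists_rep o
      by_contra! hcon
      exact hmin e (ConeGraph.isRigid_of_ker_le hk hrep hE (hcompl e)
        (X.restrict len (AddAction.orbit (ZMod k) e)ᶜ p) hx0 fun y hy => hker y (hcon y hy))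
    refine ColoredGraph.isConeLaman_of_surjective_barForm hx hsurj ?_
    have h1 := ColoredGraph.finrank_ker_barForm_add hsurj
    have h2 : LinearMap.ker (G.barForm Set.univ x) = ℝ ∙ (Complex.I • x) :=
      le_antisymm hker ((Submodule.span_singleton_le_iff_mem _ _).2 (G.barForm_I_smul _ x))
    rw [h2, finrank_span_singleton (smul_ne_zero Complex.I_ne_zero hx0), Set.ncard_univ] at h1
    exact h1
  · intro hL
    have hcard := hL.1
    have hsurj : Function.Surjective (G.barForm Set.univ x) := by
      obtain ⟨y, hy, hysurj⟩ := hL.exists_surjective_barForm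
      have h := hrank y hy
      rw [LinearMap.range_eq_top.2 hysurj, finrank_top] at h
      exact LinearMap.range_eq_top.1 (Submodule.eq_top_of_finrank_eq
        (le_antisymm (Submodule.finrank_le _) h))
    have hx0 : x ≠ 0 := by
      intro h0
      have : Nonempty (ConeOrbits k E) := (Nat.card_pos_iff.1 (by omega)).1
      refine hx (Classical.arbitrary _) ?_
      rw [h0, map_zero]
    refine ⟨ConeGraph.isRigid_of_ker_le hk hrep hE huniv p hx0 fun y hy => ?_, fun e hrigid => ?_⟩
    · have h1 := ColoredGraph.finrank_ker_barForm_add hsurj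
      rw [Set.ncard_univ] at h1
      have h2 : ℝ ∙ (Complex.I • x) = LinearMap.ker (G.barForm Set.univ x) := by
        refine Submodule.eq_of_le_of_finrank_le
          ((Submodule.span_singleton_le_iff_mem _ _).2 (G.barForm_I_smul _ x)) ?_
        rw [finrank_span_singleton (smul_ne_zero Complex.I_ne_zero hx0)]
        omega
      rw [h2]
      exact hy
    · -- the remaining edge lengths are independent, so their rank is maximal for trivial reasons
      let o : ConeOrbits k E := Quotient.mk (AddAction.orbitRel (ZMod k) E) e
      have hsurj' : Function.Surjective (G.barForm {o}ᶜ x) :=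
        ColoredGraph.barForm_surjective_mono (Set.subset_univ _) hsurj
      have hker := ConeGraph.ker_le_of_isRigid hk hrep hE (hcompl e)
        (X.restrict len (AddAction.orbit (ZMod k) e)ᶜ p)
        (Eventually.of_forall fun y => by
          change _ ≤ finrank ℝ (LinearMap.range (G.barForm _ x))
          rw [LinearMap.range_eq_top.2 hsurj', finrank_top]
          exact Submodule.finrank_le _) hrigid
      have h1 := (Submodule.finrank_mono (show LinearMap.ker (G.barForm {o}ᶜ x) ≤
        ℝ ∙ (Complex.I • x) from hker)).trans hspan
      have h2 := ColoredGraph.finrank_ker_barForm_add hsurj'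
      have h3 := Set.ncard_add_ncard_compl ({o} : Set (ConeOrbits k E))
      rw [Set.ncard_singleton] at h3
      omega
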